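/- Let $q\ge 1$ and $n\ge 1$ be integers, let $\mathbb{S}^q=\{\mathbf{x}\in\mathbb{R}^{q+1}:\|\mathbf{x}\|=1\}$, let $\sigma_q$ be the surface (Lebesgue) measure on $\mathbb{S}^q$, $\omega_q=\sigma_q(\mathbb{S}^q)=2\pi^{(q+1)/2}/\Gamma((q+1)/2)$, and let $L^2_q([-1,1])$ be the space of square-integrable real functions on $[-1,1]$ with respect to the weight $(1-x^2)^{q/2-1}$. Let $P_{k,1}=T_k$ be the Chebyshev polynomials and, for $q\ge 2$, $P_{k,q}=C_k^{(q-1)/2}$ the Gegenbauer polynomials. The Gegenbauer coefficients of $h\in L^2_q([-1,1])$ are its coefficients with respect to the orthogonal basis $\{P_{k,q}\}_{k\ge 0}$, $$\frac{\int_{-1}^1 h(x)P_{k,q}(x)(1-x^2)^{q/2-1}\,\mathrm{d}x}{\int_{-1}^1 P_{k,q}(x)^2(1-x^2)^{q/2-1}\,\mathrm{d}x},\qquad k\ge 0.$$ Let $\psi_1(\theta)=\exp(\kappa(\cos\theta-1))$ with $\kappa>0$ and $\psi_2(\theta)=(1-\rho^2)/(1-2\rho\cos\theta+\rho^2)^{(q+1)/2}$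 with $0<\rho<1$, and, for $\ell=1,2$, let $b_{k,q}(\psi_\ell)$ be the Gegenbauer coefficients of $x\mapsto\psi_\ell(\cos^{-1}x)$. For a sample $\mathbf{X}_1,\ldots,\mathbf{X}_n$ on $\mathbb{S}^q$ with angles $\theta_{ij}=\cos^{-1}(\mathbf{X}_i'\mathbf{X}_j)$, let $$T_{n,\ell}=\frac{2}{n}\sum_{1\le i<j\le n}\big(\psi_\ell(\theta_{ij})-\mathbb{E}_{\mathcal{H}_0}[\psi_\ell(\theta_{12})]\big),$$ where $\mathbb{E}_{\mathcal{H}_0}[\psi_\ell(\theta_{12})]$ is the expectation of $\psi_\ell(\cos^{-1}(\mathbf{U}'\mathbf{V}))$ for independent $\mathbf{U},\mathbf{V}$ uniformly distributed on $\mathbb{S}^q$. Suppose that, under $\mathcal{H}_1$, $\mathbf{X}_1,\ldots,\mathbf{X}_n$ are independent and identically distributed with probability density function $f_1(\mathbf{x})=g(\mathbf{x}'\boldsymbol\mu)$ with respect to $\sigma_q$, where $\boldsymbol\mu\in\mathbb{S}^q$ and $g\in L^2_q([-1,1])$, and let $e_{k,q}$ be the Gegenbauer coefficients of $g$. Let $$\tau_{k,q}=\begin{cases}(1+\delta_{k,0})^2/4,&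 q=1,\\ \left(1+2k/(q-1)\right)^{-2}(q-1)_k/k!,& q\ge 2,\end{cases}$$ where $(a)_k=a(a+1)\cdots(a+k-1)$ and $\delta_{k,0}$ is the Kronecker delta. Then $T_{n,\ell}$ is integrable under $\mathcal{H}_1$, the series below converges, and $$\mathbb{E}_{\mathcal{H}_1}[T_{n,\ell}]=\omega_q^2\,(n-1)\sum_{k=1}^{\infty}\tau_{k,q}\,b_{k,q}(\psi_\ell)\,e_{k,q}^2,\qquad \ell=1,2.$$ -/

import Mathlib

open MeasureTheory ProbabilityTheory Polynomial

namespace SphereTest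

noncomputable section

/-- The unit sphere `𝕊^q` in `ℝ^(q+1)`. -/
abbrev Sph (q : ℕ) : Type := Metric.sphere (0 : EuclideanSpace ℝ (Fin (q + 1))) 1

/-- The Euclidean scalar product `x'y` of two points of the sphere. -/
def dot {q : ℕ} (x y : Sph q) : ℝ :=
  inner ℝ (x : EuclideanSpace ℝ (Fin (q + 1))) (y : EuclideanSpace ℝ (Fin (q + 1)))

/-- The shortest angle `cos⁻¹(x'y)` between two points of the sphere. -/
def angle {q : ℕ} (x y : Sph q) : ℝ := Real.arccos (dot x y)

/-- The Lebesgue (surface area) measure `σ_q` on `𝕊^q`. -/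
def sigma (q : ℕ) : Measure (Sph q) :=
  (volume : Measure (EuclideanSpace ℝ (Fin (q + 1)))).toSphere

/-- The uniform probability measure `ν_q` on `𝕊^q`. -/
def nu (q : ℕ) : Measure (Sph q) := (sigma q Set.univ)⁻¹ • sigma q

/-- The area `ω_q` of `𝕊^q`. -/
def omega (q : ℕ) : ℝ :=
  2 * Real.pi ^ (((q : ℝ) + 1) / 2) / Real.Gamma (((q : ℝ) + 1) / 2)

/-- The Gegenbauer (ultraspherical) polynomial `C_k^α`, by the three-term recurrence
`k C_k = 2 (k + α - 1) x C_{k-1} - (k + 2 α - 2) C_{k-2}`. -/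
def gegenbauer (α : ℝ) : ℕ → ℝ[X]
  | 0 => 1
  | 1 => C (2 * α) * X
  | k + 2 =>
      C (2 * ((k : ℝ) + 1 + α) / ((k : ℝ) + 2)) * X * gegenbauer α (k + 1)
        - C (((k : ℝ) + 2 * α) / ((k : ℝ) + 2)) * gegenbauer α k

/-- The orthogonal polynomials attached to `𝕊^q`: the Chebyshev polynomials `T_k` if `q = 1`
and the Gegenbauer polynomials `C_k^{(q-1)/2}` if `q ≥ 2`. -/
def basisPoly (q k : ℕ) : ℝ[X] :=
  if q = 1 then Chebyshev.T ℝ (k : ℤ) else gegenbauer (((q : ℝ) - 1) / 2) k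

/-- The measure `(1 - x²)^{q/2 - 1} dx` on `[-1, 1]`; its space of square-integrable functions
is `L²_q([-1, 1])`. -/
def weightMeasure (q : ℕ) : Measure ℝ :=
  (volume.restrict (Set.Icc (-1 : ℝ) 1)).withDensity
    fun x => ENNReal.ofReal ((1 - x ^ 2) ^ ((q : ℝ) / 2 - 1))

/-- The `k`-th Gegenbauer (Chebyshev if `q = 1`) coefficient of a function `f` on `[-1, 1]`:
its coefficient with respect to the orthogonal basis `basisPoly q` of `L²_q([-1, 1])`. -/
def gegenbauerCoeff (q : ℕ) (f : ℝ → ℝ) (k : ℕ) : ℝ :=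
  (∫ t, f t * (basisPoly q k).eval t ∂(weightMeasure q)) /
    ∫ t, (basisPoly q k).eval t ^ 2 ∂(weightMeasure q)

/-- The Gegenbauer coefficients `b_{k,q}(ψ)` of a kernel `ψ` of the angle `θ ∈ [0, π]`, that is,
those of `ψ(θ)` as a function of `cos θ`. -/
def kernelCoeff (q : ℕ) (ψ : ℝ → ℝ) (k : ℕ) : ℝ :=
  gegenbauerCoeff q (fun t => ψ (Real.arccos t)) k

/-- The smooth maximum kernel. -/
def smoothMaxKernel (κ θ : ℝ) : ℝ := Real.exp (κ * (Real.cos θ - 1))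

/-- The Poisson kernel on `𝕊^q`. -/
def poissonKernel (q : ℕ) (ρ θ : ℝ) : ℝ :=
  (1 - ρ ^ 2) / (1 - 2 * ρ * Real.cos θ + ρ ^ 2) ^ (((q : ℝ) + 1) / 2)

/-- The expectation of `ψ(θ₁₂)` for two independent uniform points on `𝕊^q`. -/
def nullMean (q : ℕ) (ψ : ℝ → ℝ) : ℝ :=
  ∫ p : Sph q × Sph q, ψ (angle p.1 p.2) ∂((nu q).prod (nu q))

/-- The statistic `(2 / n) ∑_{i < j} (ψ(θ_ij) - E_{H₀}[ψ(θ₁₂)])` of a sample on `𝕊^q`. -/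
def testStat {q n : ℕ} (ψ : ℝ → ℝ) (x : Fin n → Sph q) : ℝ :=
  2 / (n : ℝ) * ∑ p : Fin n × Fin n with p.1 < p.2,
    (ψ (angle (x p.1) (x p.2)) - nullMean q ψ)

/-- The constants `τ_{k,q}`; `(ascPochhammer ℝ k).eval a` is `a (a + 1) ⋯ (a + k - 1)`. -/
def tau (q k : ℕ) : ℝ :=
  if q = 1 then (1 + if k = 0 then 1 else 0) ^ 2 / 4
  else (1 + 2 * (k : ℝ) / ((q : ℝ) - 1)) ^ (-2 : ℤ) *
    ((ascPochhammer ℝ k).eval ((q : ℝ) - 1) / (k.factorial : ℝ))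

end

end SphereTest

/-! By independence, every pair i < j contributes the energy `∬ g(y·μ) K(y·x) g(x·μ)` minus the null
mean, where `K = ψ ∘ arccos`; the n(n-1)/2 pairs and the prefactor 2/n give n - 1. The claim is
therefore a diagonalisation of this energy, and the kernels enter only through their continuity.

The operator with kernel `K(x·y)` is symmetric and commutes with isometries. It sends a zonal
polynomial to a zonal polynomial of no larger degree, so it acts on each `basisPoly q k` as a scalar
(`exists_funk_hecke`). The pole evaluation in `funk_hecke` identifies that scalar. The normalised
polynomials form a Hilbert basis of `L²` of the zonal measure (`span_basisLp_orthogonal`), and the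
energy is a continuous linear functional of one copy of g, so it may be summed term by term
(`hasSum_kernel_energy`). The norm identity `basisPoly_norm` turns each term into the one with
`tau`. The degree-zero term is exactly the null mean, which leaves the sum over k ≥ 1.

The link between the sphere and the weight on [-1, 1] is `zonalMeasure_eq`: both measures have
moments obeying the same recurrence, so no spherical coordinates are needed. -/

namespace SphereTest

noncomputable section

/-! ### Symmetries of the surface measure and integrals of zonal functions. -/

section Sphere

variable {q : ℕ}

/-- The action of a linear isometry on the unit sphere. -/
def sphMap (R : EuclideanSpace ℝ (Fin (q + 1)) ≃ₗᵢ[ℝ] EuclideanSpace ℝ (Fin (q + 1)))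
    (y : Sph q) : Sph q :=
  ⟨R y, by simp⟩

lemma continuous_sphMap
    (R : EuclideanSpace ℝ (Fin (q + 1)) ≃ₗᵢ[ℝ] EuclideanSpace ℝ (Fin (q + 1))) :
    Continuous (sphMap R) :=
  (R.continuous.comp continuous_subtype_val).subtype_mk _

lemma dot_sphMap (R : EuclideanSpace ℝ (Fin (q + 1)) ≃ₗᵢ[ℝ] EuclideanSpace ℝ (Fin (q + 1)))
    (x y : Sph q) : dot (sphMap R x) (sphMap R y) = dot x y :=
  R.inner_map_map _ _

lemma continuous_dot : Continuous fun p : Sph q × Sph q => dot p.1 p.2 := by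
  unfold dot; fun_prop

lemma continuous_dot_left (μ : Sph q) : Continuous fun x : Sph q => dot x μ := by
  unfold dot; fun_prop

lemma continuous_dot_right (μ : Sph q) : Continuous fun x : Sph q => dot μ x := by
  unfold dot; fun_prop

lemma dot_comm (x y : Sph q) : dot x y = dot y x := real_inner_comm _ _

lemma dot_self (x : Sph q) : dot x x = 1 := by
  simp [dot]

lemma abs_dot_le_one (x y : Sph q) : |dot x y| ≤ 1 := by
  simpa [dot] using abs_real_inner_le_norm (x : EuclideanSpace ℝ (Fin (q + 1))) y

lemma dot_mem_Icc (x y : Sph q) : dot x y ∈ Set.Icc (-1 : ℝ) 1 :=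
  abs_le.1 (abs_dot_le_one x y)

instance : IsFiniteMeasure (sigma q) := by unfold sigma; infer_instance

/-- The surface measure is defined by volumes of cones over subsets, and a linear isometry carries
cones to cones while preserving volume. -/
lemma measurePreserving_sphMap
    (R : EuclideanSpace ℝ (Fin (q + 1)) ≃ₗᵢ[ℝ] EuclideanSpace ℝ (Fin (q + 1))) :
    MeasurePreserving (sphMap R) (sigma q) (sigma q) := by
  refine ⟨(continuous_sphMap R).measurable, ?_⟩
  ext s hs
  rw [Measure.map_apply (continuous_sphMap R).measurable hs, sigma, Measure.toSphere_apply' _ hs,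
    Measure.toSphere_apply' _ ((continuous_sphMap R).measurable hs)]
  congr 1
  have hpre : ∀ t : Set (EuclideanSpace ℝ (Fin (q + 1))), volume (R ⁻¹' t) = volume t := fun t =>
    R.measurePreserving.measure_preimage_equiv (f := R.toMeasurableEquiv) t
  conv_rhs => rw [← hpre]
  congr 1
  ext v
  simp only [Set.mem_smul, Set.mem_image, Set.mem_preimage]
  constructor
  · rintro ⟨r, hr, _, ⟨y, hy, rfl⟩, rfl⟩
    exact ⟨r, hr, _, ⟨_, hy, rfl⟩, by simp [sphMap]⟩
  · rintro ⟨r, hr, _, ⟨y, hy, rfl⟩, h⟩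
    refine ⟨r, hr, _, ⟨sphMap R.symm y, ?_, rfl⟩, ?_⟩
    · convert hy
      simp [sphMap]
    · apply R.injective
      simpa [sphMap] using h

lemma integral_sphMap
    (R : EuclideanSpace ℝ (Fin (q + 1)) ≃ₗᵢ[ℝ] EuclideanSpace ℝ (Fin (q + 1)))
    {F : Sph q → ℝ} (hF : Continuous F) :
    ∫ y, F (sphMap R y) ∂(sigma q) = ∫ y, F y ∂(sigma q) := by
  conv_rhs => rw [← (measurePreserving_sphMap R).map_eq]
  rw [integral_map (continuous_sphMap R).aemeasurable hF.aestronglyMeasurable]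

/-- The reflection in the hyperplane orthogonal to `x - x'` does it: it fixes every point having
equal scalar products with `x` and `x'`. -/
lemma exists_isometry_map (x x' : Sph q) :
    ∃ R : EuclideanSpace ℝ (Fin (q + 1)) ≃ₗᵢ[ℝ] EuclideanSpace ℝ (Fin (q + 1)),
      sphMap R x = x' ∧ ∀ z : Sph q, dot z x = dot z x' → sphMap R z = z := by
  refine ⟨(ℝ ∙ ((x : EuclideanSpace ℝ (Fin (q + 1))) - x'))ᗮ.reflection, ?_, fun z hz => ?_⟩
  · exact Subtype.ext (Submodule.reflection_sub (by simp))
  · refine Subtype.ext (Submodule.reflection_mem_subspace_eq_self ?_)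
    rw [Submodule.mem_orthogonal_singleton_iff_inner_left, inner_sub_right]
    exact sub_eq_zero.2 hz

/-- Two reflections suffice: once `x` has reached `x'`, the reflection that moves the image of `μ`
to `μ'` fixes `x'`, because the scalar products agree. -/
lemma exists_isometry_map_pair {x μ x' μ' : Sph q} (h : dot x μ = dot x' μ') :
    ∃ R : EuclideanSpace ℝ (Fin (q + 1)) ≃ₗᵢ[ℝ] EuclideanSpace ℝ (Fin (q + 1)),
      sphMap R x = x' ∧ sphMap R μ = μ' := by
  obtain ⟨R, hR, -⟩ := exists_isometry_map x x'
  obtain ⟨S, hS, hS'⟩ := exists_isometry_map (sphMap R μ) μ'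
  refine ⟨R.trans S, ?_, hS⟩
  have : sphMap S x' = x' := hS' _ (by rw [← hR, dot_sphMap, h, hR])
  rw [← this, ← hR]; rfl

/-- The `i`-th standard basis vector as a point of the sphere. -/
def basisPoint (i : Fin (q + 1)) : Sph q := ⟨EuclideanSpace.single i 1, by simp⟩

lemma dot_basisPoint (y : Sph q) (i : Fin (q + 1)) : dot y (basisPoint i) = y.1 i := by
  simp [dot, basisPoint, EuclideanSpace.inner_single_right]

lemma sum_sq_coord (y : Sph q) : ∑ i, y.1 i ^ 2 = 1 := by
  have := EuclideanSpace.real_norm_sq_eq y.1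
  simpa using this.symm

lemma dot_basisPoint_self_last (hq : 1 ≤ q) :
    dot (basisPoint (0 : Fin (q + 1))) (basisPoint (Fin.last q)) = 0 := by
  have : Fin.last q ≠ 0 := by simp [Fin.ext_iff]; omega
  rw [dot_basisPoint]; simp [basisPoint, this]

/-- The point of the circle through two basis vectors with first coordinate `s`. -/
def arcPoint (hq : 1 ≤ q) {a b : ℝ} (h : a ^ 2 + b ^ 2 = 1) : Sph q :=
  ⟨EuclideanSpace.single 0 a + EuclideanSpace.single (Fin.last q) b, by
    have hne : (0 : Fin (q + 1)) ≠ Fin.last q := by simp [Fin.ext_iff]; omega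
    rw [mem_sphere_zero_iff_norm, ← sq_eq_sq₀ (norm_nonneg _) zero_le_one, norm_add_sq_real]
    simp [hne, h, EuclideanSpace.inner_single_right]⟩

lemma dot_arcPoint (hq : 1 ≤ q) {a b : ℝ} (h : a ^ 2 + b ^ 2 = 1) (y : Sph q) :
    dot y (arcPoint hq h) = a * y.1 0 + b * y.1 (Fin.last q) := by
  simp [dot, arcPoint, inner_add_right, EuclideanSpace.inner_single_right]

lemma basisPoint_zero_coord_zero : (basisPoint (0 : Fin (q + 1))).1 0 = 1 := by
  simp [basisPoint]

lemma basisPoint_zero_coord_last (hq : 1 ≤ q) :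
    (basisPoint (0 : Fin (q + 1))).1 (Fin.last q) = 0 := by
  rw [← dot_basisPoint, dot_basisPoint_self_last hq]

lemma integrable_of_continuous {F : Sph q → ℝ} (hF : Continuous F) : Integrable F (sigma q) := by
  obtain ⟨C, hC⟩ := (isCompact_range hF).isBounded.exists_norm_le
  exact Integrable.of_bound hF.aestronglyMeasurable C
    (Filter.Eventually.of_forall fun x => hC _ ⟨x, rfl⟩)

lemma integral_dot_pair_eq {x μ x' μ' : Sph q} (h : dot x μ = dot x' μ') {K p : ℝ → ℝ}
    (hK : Continuous K) (hp : Continuous p) :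
    ∫ y, K (dot x y) * p (dot y μ) ∂(sigma q) = ∫ y, K (dot x' y) * p (dot y μ') ∂(sigma q) := by
  obtain ⟨R, h1, h2⟩ := exists_isometry_map_pair h
  have hc : Continuous fun y => K (dot x' y) * p (dot y μ') :=
    (hK.comp (continuous_dot_right x')).mul (hp.comp (continuous_dot_left μ'))
  rw [← integral_sphMap R hc]
  simp only [← h1, ← h2, dot_sphMap]

lemma integral_coord_odd (hq : 1 ≤ q) {F : ℝ → ℝ} (hF : Continuous F) {j : ℕ} (hj : Odd j) :
    ∫ y : Sph q, F (y.1 0) * y.1 (Fin.last q) ^ j ∂(sigma q) = 0 := by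
  have hne : (0 : Fin (q + 1)) ≠ Fin.last q := by simp [Fin.ext_iff]; omega
  have hc : Continuous fun y : Sph q => F (y.1 0) * y.1 (Fin.last q) ^ j := by fun_prop
  -- `m` is the negative of the last basis vector, so the isometry below flips the last coordinate
  -- and fixes the zeroth.
  let m : Sph q := arcPoint hq (a := 0) (b := -1) (by norm_num)
  obtain ⟨R, h1, h2⟩ := exists_isometry_map (basisPoint (Fin.last q)) m
  have e0 : sphMap R (basisPoint 0) = basisPoint 0 := h2 _ (by
    rw [dot_basisPoint_self_last hq, dot_arcPoint, basisPoint_zero_coord_last hq]; simp)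
  have key := integral_sphMap R hc
  have hrefl : ∀ y : Sph q, (sphMap R y).1 0 = y.1 0 ∧
      (sphMap R y).1 (Fin.last q) = - y.1 (Fin.last q) := by
    intro y
    constructor
    · rw [← dot_basisPoint, ← e0, dot_sphMap, dot_basisPoint]
    · have h3 : dot (sphMap R y) m = y.1 (Fin.last q) := by rw [← h1, dot_sphMap, dot_basisPoint]
      rw [dot_arcPoint] at h3
      linarith
  simp only [(hrefl _).1, (hrefl _).2, hj.neg_pow, mul_neg, integral_neg] at key
  linarith

/-- With s the scalar product, rotate the pair to e₀ and s e₀ + √(1 - s²) e_last and expand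
binomially. Odd powers of the square root come with odd powers of the last coordinate, whose
integrals vanish; even powers are polynomials in s. -/
lemma exists_polynomial_integral_kernel_pow (hq : 1 ≤ q) {K : ℝ → ℝ} (hK : Continuous K) (m : ℕ) :
    ∃ Q : ℝ[X], Q.natDegree ≤ m ∧ ∀ x μ : Sph q,
      ∫ y, K (dot x y) * dot y μ ^ m ∂(sigma q) = Q.eval (dot x μ) := by
  let A : ℕ → ℝ := fun j => ∫ y : Sph q, (K (y.1 0) * y.1 0 ^ (m - j)) * y.1 (Fin.last q) ^ j
    ∂(sigma q)
  have hA : ∀ j, Odd j → A j = 0 := fun j hj =>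
    integral_coord_odd hq (F := fun t => K t * t ^ (m - j)) (by fun_prop) hj
  refine ⟨∑ j ∈ Finset.range (m + 1), C (m.choose j * A j) * X ^ (m - j) * (1 - X ^ 2) ^ (j / 2),
    ?_, fun x μ => ?_⟩
  · refine natDegree_sum_le_of_forall_le _ _ fun j hj => ?_
    have hj' : j ≤ m := by simpa [Nat.lt_succ_iff] using hj
    have h1 : (1 - X ^ 2 : ℝ[X]).natDegree ≤ 2 :=
      (natDegree_sub_le _ _).trans (by simp)
    calc _ ≤ (m - j) + (j / 2) * 2 := by
          refine natDegree_mul_le.trans (add_le_add ?_ ?_)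
          · exact natDegree_C_mul_X_pow_le _ _
          · exact natDegree_pow_le.trans (Nat.mul_le_mul_left _ h1)
      _ ≤ m := by omega
  · set s := dot x μ with hs
    have hs1 : 0 ≤ 1 - s ^ 2 := by
      have := abs_dot_le_one x μ
      rw [← hs, ← sq_le_one_iff_abs_le_one] at this
      linarith
    have hsq : s ^ 2 + √(1 - s ^ 2) ^ 2 = 1 := by rw [Real.sq_sqrt hs1]; ring
    have h0 : dot x μ = dot (basisPoint 0) (arcPoint hq hsq) := by
      rw [dot_arcPoint, basisPoint_zero_coord_zero, basisPoint_zero_coord_last hq]; simp [hs]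
    rw [integral_dot_pair_eq h0 hK (p := fun t => t ^ m) (by fun_prop)]
    have h2 : ∀ y : Sph q, K (dot (basisPoint 0) y) * dot y (arcPoint hq hsq) ^ m =
        ∑ j ∈ Finset.range (m + 1), (m.choose j * (s ^ (m - j) * √(1 - s ^ 2) ^ j)) *
          ((K (y.1 0) * y.1 0 ^ (m - j)) * y.1 (Fin.last q) ^ j) := by
      intro y
      rw [dot_arcPoint, dot_comm, dot_basisPoint, add_comm (s * _), add_pow, Finset.mul_sum]
      refine Finset.sum_congr rfl fun j _ => ?_
      rw [mul_pow, mul_pow]; ring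
    simp only [h2]
    rw [integral_finsetSum _ fun j _ => (integrable_of_continuous (by fun_prop)).const_mul _,
      eval_finsetSum]
    refine Finset.sum_congr rfl fun j _ => ?_
    rw [integral_const_mul]
    change _ * A j = _
    rcases Nat.even_or_odd j with ⟨i, hi⟩ | hj
    · have h3 : √(1 - s ^ 2) ^ j = (1 - s ^ 2) ^ (j / 2) := by
        rw [show j = 2 * (j / 2) by omega, pow_mul, Real.sq_sqrt hs1]; congr 1; omega
      rw [h3]; simp; ring
    · simp [hA j hj]

lemma exists_polynomial_integral_kernel (hq : 1 ≤ q) {K : ℝ → ℝ} (hK : Continuous K) (p : ℝ[X]) :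
    ∃ Q : ℝ[X], Q.natDegree ≤ p.natDegree ∧ ∀ x μ : Sph q,
      ∫ y, K (dot x y) * p.eval (dot y μ) ∂(sigma q) = Q.eval (dot x μ) := by
  choose Q hQ hQe using exists_polynomial_integral_kernel_pow hq hK
  refine ⟨∑ j ∈ Finset.range (p.natDegree + 1), C (p.coeff j) * Q j, ?_, fun x μ => ?_⟩
  · refine natDegree_sum_le_of_forall_le _ _ fun j hj => ?_
    exact (natDegree_C_mul_le _ _).trans ((hQ j).trans (by simpa [Nat.lt_succ_iff] using hj))
  · simp only [eval_eq_sum_range, Finset.mul_sum]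
    have hc : ∀ j, Continuous fun y : Sph q => K (dot x y) * (p.coeff j * dot y μ ^ j) := fun j =>
      (hK.comp (continuous_dot_right x)).mul (((continuous_dot_left μ).pow j).const_mul _)
    rw [integral_finsetSum _ fun j _ => integrable_of_continuous (hc j)]
    rw [← eval_eq_sum_range, eval_finsetSum]
    refine Finset.sum_congr rfl fun j _ => ?_
    simp only [mul_left_comm _ (p.coeff j), integral_const_mul, hQe, eval_mul, eval_C]

lemma integral_comp_dot_eq {F : ℝ → ℝ} (hF : Continuous F) (μ μ' : Sph q) :
    ∫ y, F (dot y μ) ∂(sigma q) = ∫ y, F (dot y μ') ∂(sigma q) := by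
  simpa using integral_dot_pair_eq (x := μ) (μ := μ) (x' := μ') (μ' := μ')
    (by rw [dot_self, dot_self]) (K := fun _ => 1) continuous_const hF

lemma integral_dot_pow_odd (μ : Sph q) {j : ℕ} (hj : Odd j) :
    ∫ y, dot y μ ^ j ∂(sigma q) = 0 := by
  have hc : Continuous fun y : Sph q => dot y μ ^ j := (continuous_dot_left μ).pow j
  have key := integral_sphMap (LinearIsometryEquiv.neg ℝ) hc
  have : ∀ y : Sph q, dot (sphMap (LinearIsometryEquiv.neg ℝ) y) μ = - dot y μ := by
    intro y; simp [dot, sphMap]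
  simp only [this, hj.neg_pow, integral_neg] at key
  linarith

/-- The linear form is √(1 + b²) times the scalar product with a unit vector, and the integral does
not depend on that unit vector. -/
lemma integral_linear_comb_pow (hq : 1 ≤ q) (m : ℕ) (b : ℝ) :
    ∫ y : Sph q, (y.1 0 + b * y.1 (Fin.last q)) ^ (2 * m) ∂(sigma q) =
      (1 + b ^ 2) ^ m * ∫ y : Sph q, y.1 0 ^ (2 * m) ∂(sigma q) := by
  set r := √(1 + b ^ 2) with hr
  have hr0 : 0 < r := Real.sqrt_pos.2 (by positivity)
  have hr2 : r ^ 2 = 1 + b ^ 2 := Real.sq_sqrt (by positivity)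
  have h : (1 / r) ^ 2 + (b / r) ^ 2 = 1 := by field_simp; linarith
  have h1 : ∀ y : Sph q, (y.1 0 + b * y.1 (Fin.last q)) ^ (2 * m) =
      (1 + b ^ 2) ^ m * dot y (arcPoint hq h) ^ (2 * m) := by
    intro y
    rw [dot_arcPoint, ← hr2, ← pow_mul, ← mul_pow]
    congr 1; field_simp
  simp only [h1]
  rw [integral_const_mul, integral_comp_dot_eq (F := fun t => t ^ (2 * m)) (by fun_prop) _
    (basisPoint 0)]
  simp only [dot_basisPoint]

/-- Both sides of `integral_linear_comb_pow` are polynomials in b; comparing the coefficients of b²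
gives this relation. -/
lemma integral_coord_sq (hq : 1 ≤ q) (m : ℕ) :
    (2 * m + 1) * ∫ y : Sph q, y.1 0 ^ (2 * m) * y.1 (Fin.last q) ^ 2 ∂(sigma q) =
      ∫ y : Sph q, y.1 0 ^ (2 * m + 2) ∂(sigma q) := by
  set M := ∫ y : Sph q, y.1 0 ^ (2 * (m + 1)) ∂(sigma q) with hM
  let A : ℕ → ℝ := fun j => ∫ y : Sph q, y.1 0 ^ (2 * (m + 1) - j) * y.1 (Fin.last q) ^ j ∂(sigma q)
  have hpoly : (∑ j ∈ Finset.range (2 * (m + 1) + 1), C ((2 * (m + 1)).choose j * A j) * X ^ j) =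
      C M * expand ℝ 2 ((1 + X) ^ (m + 1)) := by
    refine Polynomial.funext fun b => ?_
    rw [eval_finsetSum]
    simp only [eval_mul, eval_C, eval_pow, eval_X, expand_eval, eval_add, eval_one]
    rw [mul_comm M, hM, ← integral_linear_comb_pow hq (m + 1) b]
    have h2 : ∀ y : Sph q, (y.1 0 + b * y.1 (Fin.last q)) ^ (2 * (m + 1)) =
        ∑ j ∈ Finset.range (2 * (m + 1) + 1), ((2 * (m + 1)).choose j * b ^ j) *
          (y.1 0 ^ (2 * (m + 1) - j) * y.1 (Fin.last q) ^ j) := by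
      intro y
      rw [add_comm (y.1 0), add_pow]
      refine Finset.sum_congr rfl fun j _ => ?_
      rw [mul_pow]; ring
    simp only [h2]
    rw [integral_finsetSum _ fun j _ => (integrable_of_continuous (by fun_prop)).const_mul _]
    refine Finset.sum_congr rfl fun j _ => ?_
    rw [integral_const_mul]
    change _ = _ * A j
    ring
  have h2 := congrArg (fun p => p.coeff 2) hpoly
  simp only [finsetSum_coeff, coeff_C_mul, coeff_X_pow] at h2
  -- In the polynomial in X², the coefficient at 2 is the coefficient of 1 + X to the power m + 1 at
  -- 1.
  rw [show (2 : ℕ) = 1 * 2 from rfl, coeff_expand_mul (by norm_num), coeff_one_add_X_pow] at h2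
  simp only [mul_ite, mul_one, mul_zero, one_mul] at h2
  rw [Finset.sum_ite_eq, if_pos (by simp)] at h2
  have hch : (((2 * (m + 1)).choose 2 : ℕ) : ℝ) = (m + 1) * (2 * m + 1) := by
    rw [Nat.cast_choose_two]; push_cast; ring
  have hA2 : A 2 = ∫ y : Sph q, y.1 0 ^ (2 * m) * y.1 (Fin.last q) ^ 2 ∂(sigma q) := by
    simp only [A]; rw [show 2 * (m + 1) - 2 = 2 * m by omega]
  rw [hch, Nat.choose_one_right, hA2] at h2
  have hm : (m + 1 : ℝ) ≠ 0 := by positivity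
  have : (m + 1 : ℝ) * ((2 * m + 1) * ∫ y : Sph q, y.1 0 ^ (2 * m) * y.1 (Fin.last q) ^ 2
    ∂(sigma q)) = (m + 1) * M := by push_cast at h2; linarith
  exact mul_left_cancel₀ hm this

lemma integral_coord_sq_eq (i : Fin (q + 1)) (hi : i ≠ 0) (m : ℕ) :
    ∫ y : Sph q, y.1 0 ^ m * y.1 i ^ 2 ∂(sigma q) =
      ∫ y : Sph q, y.1 0 ^ m * y.1 (Fin.last q) ^ 2 ∂(sigma q) := by
  have hq : 1 ≤ q := by
    by_contra h
    have : q = 0 := by omega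
    subst this
    exact hi (Fin.ext (by omega))
  have h : dot (basisPoint 0) (basisPoint i) = dot (basisPoint (0 : Fin (q + 1)))
      (basisPoint (Fin.last q)) := by
    rw [dot_basisPoint_self_last hq, dot_basisPoint]; simp [basisPoint, hi]
  simpa [dot_basisPoint, dot_comm (basisPoint 0)] using
    integral_dot_pair_eq h (K := fun t => t ^ m) (p := fun t => t ^ 2) (by fun_prop) (by fun_prop)

/-- For even m, 1 - y₀² is the sum of the other q squared coordinates, which contribute equally. For
odd m both moments vanish by the antipodal map. -/
lemma integral_dot_pow_recurrence (hq : 1 ≤ q) (μ : Sph q) (m : ℕ) :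
    (m + 1) * ((∫ y, dot y μ ^ m ∂(sigma q)) - ∫ y, dot y μ ^ (m + 2) ∂(sigma q)) =
      q * ∫ y, dot y μ ^ (m + 2) ∂(sigma q) := by
  rcases Nat.even_or_odd' m with ⟨k, rfl | rfl⟩
  · have hsw : ∀ j : ℕ, ∫ y, dot y μ ^ j ∂(sigma q) = ∫ y : Sph q, y.1 0 ^ j ∂(sigma q) := by
      intro j
      rw [integral_comp_dot_eq (F := fun t => t ^ j) (by fun_prop) μ (basisPoint 0)]
      simp only [dot_basisPoint]
    rw [hsw, hsw]
    have h1 : ∀ y : Sph q, y.1 0 ^ (2 * k) - y.1 0 ^ (2 * k + 2) =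
        ∑ i : Fin q, y.1 0 ^ (2 * k) * y.1 i.succ ^ 2 := by
      intro y
      have := sum_sq_coord y
      rw [Fin.sum_univ_succ] at this
      rw [← Finset.mul_sum, eq_sub_iff_add_eq'.2 this]; ring
    rw [← integral_sub (integrable_of_continuous (by fun_prop))
      (integrable_of_continuous (by fun_prop))]
    simp only [h1]
    rw [integral_finsetSum _ fun j _ => integrable_of_continuous (by fun_prop),
      Finset.sum_congr rfl fun i _ => integral_coord_sq_eq i.succ (Fin.succ_ne_zero i) (2 * k)]
    have := integral_coord_sq hq k
    simp only [Finset.sum_const, Finset.card_univ, Fintype.card_fin, nsmul_eq_mul]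
    rw [← this]; push_cast; ring
  · rw [integral_dot_pow_odd μ ⟨k, rfl⟩, integral_dot_pow_odd μ ⟨k + 1, by ring⟩]; simp

/-- The area is the dimension times the volume of the unit ball, and Γ(s + 1) = s Γ(s) absorbs the
dimension. -/
lemma sigma_univ_toReal : (sigma q).real Set.univ = omega q := by
  rw [sigma, Measure.toSphere_real_apply_univ, measureReal_def, EuclideanSpace.volume_ball]
  have hG : Real.Gamma (((q : ℝ) + 1) / 2 + 1) =
      ((q : ℝ) + 1) / 2 * Real.Gamma (((q : ℝ) + 1) / 2) :=
    Real.Gamma_add_one (by positivity)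
  have hpos : 0 < Real.Gamma (((q : ℝ) + 1) / 2) := Real.Gamma_pos_of_pos (by positivity)
  have hpi : √Real.pi ^ (q + 1) = Real.pi ^ (((q : ℝ) + 1) / 2) := by
    rw [Real.sqrt_eq_rpow, ← Real.rpow_natCast, ← Real.rpow_mul Real.pi_pos.le]
    congr 1; push_cast; ring
  simp only [finrank_euclideanSpace, Fintype.card_fin, ENNReal.ofReal_one, one_pow, one_mul]
  push_cast
  rw [hG, ENNReal.toReal_ofReal (by positivity), hpi, omega]
  field_simp

lemma omega_pos : 0 < omega q := by
  have : 0 < Real.Gamma (((q : ℝ) + 1) / 2) := Real.Gamma_pos_of_pos (by positivity)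
  have := Real.pi_pos
  unfold omega; positivity

end Sphere

/-! ### The weight on [-1, 1] as the law of a scalar product. -/

section Weight

lemma integrable_mul_continuous_of_Icc {m : Measure ℝ} (hm : ∀ᵐ t ∂m, t ∈ Set.Icc (-1 : ℝ) 1)
    {f h : ℝ → ℝ} (hf : Integrable f m) (hh : Continuous h) : Integrable (fun t => f t * h t) m := by
  obtain ⟨C, hC⟩ := (isCompact_Icc (a := (-1 : ℝ)) (b := 1)).exists_bound_of_continuousOn
    hh.continuousOn
  exact hf.mul_bdd (c := C) hh.aestronglyMeasurable (hm.mono hC)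

lemma abs_integral_mul_sub_le {m : Measure ℝ} (hm : ∀ᵐ t ∂m, t ∈ Set.Icc (-1 : ℝ) 1)
    {f h p : ℝ → ℝ} (hf : Integrable f m) (hh : Continuous h) (hp : Continuous p) {ε : ℝ}
    (hε : ∀ t ∈ Set.Icc (-1 : ℝ) 1, |p t - h t| < ε) :
    |(∫ t, f t * p t ∂m) - ∫ t, f t * h t ∂m| ≤ ε * ∫ t, |f t| ∂m := by
  rw [← integral_sub (integrable_mul_continuous_of_Icc hm hf hp)
    (integrable_mul_continuous_of_Icc hm hf hh), ← integral_const_mul, ← Real.norm_eq_abs]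
  refine norm_integral_le_of_norm_le (hf.abs.const_mul ε) (hm.mono fun t ht => ?_)
  rw [← mul_sub, norm_mul, mul_comm, Real.norm_eq_abs, Real.norm_eq_abs]
  exact mul_le_mul_of_nonneg_right (hε t ht).le (abs_nonneg _)

/-- On a compact interval, integrals against continuous functions are determined by the moments. -/
lemma integral_mul_continuous_eq_of_polynomial {m₁ m₂ : Measure ℝ}
    (hm₁ : ∀ᵐ t ∂m₁, t ∈ Set.Icc (-1 : ℝ) 1) (hm₂ : ∀ᵐ t ∂m₂, t ∈ Set.Icc (-1 : ℝ) 1)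
    {f₁ f₂ : ℝ → ℝ} (hf₁ : Integrable f₁ m₁) (hf₂ : Integrable f₂ m₂)
    (h : ∀ p : ℝ[X], ∫ t, f₁ t * p.eval t ∂m₁ = ∫ t, f₂ t * p.eval t ∂m₂)
    {φ : ℝ → ℝ} (hφ : Continuous φ) : ∫ t, f₁ t * φ t ∂m₁ = ∫ t, f₂ t * φ t ∂m₂ := by
  set D := (∫ t, |f₁ t| ∂m₁) + ∫ t, |f₂ t| ∂m₂ with hD
  have hD0 : 0 ≤ D := add_nonneg (integral_nonneg fun _ => abs_nonneg _)
    (integral_nonneg fun _ => abs_nonneg _)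
  refine eq_of_abs_sub_le_all fun ε hε => ?_
  -- Weierstrass approximation; `D + 1` replaces `D`, which may be zero.
  obtain ⟨p, hp⟩ := exists_polynomial_near_of_continuousOn (-1) 1 φ hφ.continuousOn
    (ε / (D + 1)) (by positivity)
  have h1 := abs_integral_mul_sub_le hm₁ hf₁ hφ p.continuous hp
  have h2 := abs_integral_mul_sub_le hm₂ hf₂ hφ p.continuous hp
  rw [h p] at h1
  have h3 : ε / (D + 1) * D ≤ ε := by
    rw [div_mul_eq_mul_div, div_le_iff₀ (by positivity)]; nlinarith
  rw [hD, mul_add] at h3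
  rw [abs_le] at *
  constructor <;> linarith [h1.1, h1.2, h2.1, h2.2]

lemma ae_weightMeasure_mem_Icc (q : ℕ) : ∀ᵐ t ∂(weightMeasure q), t ∈ Set.Icc (-1 : ℝ) 1 :=
  (withDensity_absolutelyContinuous _ _).ae_le (ae_restrict_mem measurableSet_Icc)

lemma one_sub_sq_nonneg {t : ℝ} (ht : t ∈ Set.Icc (-1 : ℝ) 1) : 0 ≤ 1 - t ^ 2 := by
  nlinarith [ht.1, ht.2]

lemma one_sub_sq_pos {t : ℝ} (ht : t ∈ Set.Ioo (-1 : ℝ) 1) : 0 < 1 - t ^ 2 := by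
  nlinarith [ht.1, ht.2]

lemma intervalIntegrable_weight {q : ℕ} (hq : 1 ≤ q) :
    IntervalIntegrable (fun t : ℝ => (1 - t ^ 2) ^ ((q : ℝ) / 2 - 1)) volume (-1) 1 := by
  rcases hq.eq_or_lt with rfl | h
  -- Only for q = 1 is the exponent negative, the weight then being unbounded at ±1.
  · refine Polynomial.Chebyshev.intervalIntegrable_sqrt_one_sub_sq_inv.congr_uIoo fun t ht => ?_
    rw [Set.uIoo_of_le (by norm_num)] at ht
    have := one_sub_sq_pos ht
    change (√(1 - t ^ 2)⁻¹ : ℝ) = _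
    rw [Real.sqrt_inv, Real.sqrt_eq_rpow, ← Real.rpow_neg this.le]
    norm_num
  · have : (0 : ℝ) ≤ (q : ℝ) / 2 - 1 := by
      have : (2 : ℝ) ≤ q := by exact_mod_cast h
      linarith
    exact ((continuous_const.sub (continuous_pow 2)).rpow_const
      fun _ => Or.inr this).intervalIntegrable _ _

lemma integral_weightMeasure (q : ℕ) (f : ℝ → ℝ) :
    ∫ t, f t ∂(weightMeasure q) = ∫ t in (-1)..1, (1 - t ^ 2) ^ ((q : ℝ) / 2 - 1) * f t := by
  rw [weightMeasure, integral_withDensity_eq_integral_toReal_smul (by fun_prop)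
    (Filter.Eventually.of_forall fun _ => ENNReal.ofReal_lt_top),
    intervalIntegral.integral_of_le (by norm_num), ← integral_Icc_eq_integral_Ioc]
  refine setIntegral_congr_fun measurableSet_Icc fun t ht => ?_
  simp only [smul_eq_mul]
  rw [ENNReal.toReal_ofReal (Real.rpow_nonneg (one_sub_sq_nonneg ht) _)]

lemma isFiniteMeasure_weightMeasure {q : ℕ} (hq : 1 ≤ q) : IsFiniteMeasure (weightMeasure q) := by
  refine isFiniteMeasure_withDensity_ofReal ?_
  have := (intervalIntegrable_iff_integrableOn_Icc_of_le (by norm_num)).1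
    (intervalIntegrable_weight hq)
  exact this.2

lemma weightMeasure_real_univ_pos {q : ℕ} (hq : 1 ≤ q) : 0 < (weightMeasure q).real Set.univ := by
  have h := integral_weightMeasure q fun _ => 1
  simp only [mul_one, integral_const, smul_eq_mul] at h
  rw [h]
  exact intervalIntegral.intervalIntegral_pos_of_pos_on (intervalIntegrable_weight hq)
    (fun t ht => Real.rpow_pos_of_pos (one_sub_sq_pos ht) _) (by norm_num)

/-- Integration by parts against the weight. -/
lemma integral_weightMeasure_derivative {q : ℕ} (hq : 1 ≤ q) (p : ℝ[X]) :
    ∫ t, ((1 - X ^ 2) * derivative p - C (q : ℝ) * X * p).eval t ∂(weightMeasure q) = 0 := by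
  have hq0 : (0 : ℝ) < q / 2 := by
    have : (1 : ℝ) ≤ q := by exact_mod_cast hq
    linarith
  rw [integral_weightMeasure]
  have hint : IntervalIntegrable (fun t : ℝ => (1 - t ^ 2) ^ ((q : ℝ) / 2 - 1) *
      ((1 - X ^ 2) * derivative p - C (q : ℝ) * X * p).eval t) volume (-1) 1 :=
    (intervalIntegrable_weight hq).mul_continuousOn (Polynomial.continuous _).continuousOn
  -- The integrand is the derivative of `p(t)(1 - t²)^(q/2)`, which vanishes at ±1 because q > 0.
  rw [intervalIntegral.integral_eq_sub_of_hasDerivAt_of_le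
    (f := fun t => p.eval t * (1 - t ^ 2) ^ ((q : ℝ) / 2)) (by norm_num) ?_ ?_ hint]
  · norm_num [Real.zero_rpow hq0.ne']
  · exact (p.continuous.mul ((continuous_const.sub (continuous_pow 2)).rpow_const
      fun _ => Or.inr hq0.le)).continuousOn
  · intro t ht
    have hpos := one_sub_sq_pos ht
    have h1 : HasDerivAt (fun t : ℝ => 1 - t ^ 2) (-(2 * t)) t := by
      simpa using (hasDerivAt_pow 2 t).const_sub 1
    have h2 := (p.hasDerivAt t).mul (h1.rpow_const (p := (q : ℝ) / 2) (Or.inl hpos.ne'))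
    refine h2.congr_deriv ?_
    have h3 : (1 - t ^ 2) ^ ((q : ℝ) / 2) = (1 - t ^ 2) ^ ((q : ℝ) / 2 - 1) * (1 - t ^ 2) := by
      rw [← Real.rpow_add_one hpos.ne']; simp
    simp only [eval_sub, eval_mul, eval_one, eval_pow, eval_X, eval_C]
    rw [h3]; ring

/-- The distribution of the scalar product with a fixed pole. -/
def zonalMeasure {q : ℕ} (μ : Sph q) : Measure ℝ := (sigma q).map fun x => dot x μ

variable {q : ℕ}

instance (μ : Sph q) : IsFiniteMeasure (zonalMeasure μ) := by
  unfold zonalMeasure; infer_instance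

lemma measurePreserving_dot (μ : Sph q) :
    MeasurePreserving (fun x => dot x μ) (sigma q) (zonalMeasure μ) :=
  ⟨(continuous_dot_left μ).measurable, rfl⟩

lemma integral_zonalMeasure (μ : Sph q) {f : ℝ → ℝ}
    (hf : AEStronglyMeasurable f (zonalMeasure μ)) :
    ∫ t, f t ∂(zonalMeasure μ) = ∫ x, f (dot x μ) ∂(sigma q) :=
  integral_map (continuous_dot_left μ).aemeasurable hf

lemma integral_zonalMeasure_polynomial (μ : Sph q) (p : ℝ[X]) :
    ∫ t, p.eval t ∂(zonalMeasure μ) = ∫ x, p.eval (dot x μ) ∂(sigma q) :=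
  integral_zonalMeasure μ p.continuous.aestronglyMeasurable

lemma ae_zonalMeasure_mem_Icc (μ : Sph q) : ∀ᵐ t ∂(zonalMeasure μ), t ∈ Set.Icc (-1 : ℝ) 1 := by
  refine (ae_map_iff (continuous_dot_left μ).aemeasurable measurableSet_Icc).2 ?_
  exact Filter.Eventually.of_forall fun x => dot_mem_Icc x μ

lemma integrable_continuous_of_Icc {m : Measure ℝ} [IsFiniteMeasure m]
    (hm : ∀ᵐ t ∂m, t ∈ Set.Icc (-1 : ℝ) 1) {h : ℝ → ℝ} (hh : Continuous h) : Integrable h m := by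
  simpa using integrable_mul_continuous_of_Icc hm (integrable_const 1) hh

lemma zonalMeasure_real_univ (μ : Sph q) : (zonalMeasure μ).real Set.univ = omega q := by
  rw [← sigma_univ_toReal, zonalMeasure,
    map_measureReal_apply (continuous_dot_left μ).measurable MeasurableSet.univ, Set.preimage_univ]

/-- Both moment sequences satisfy the same two-step recurrence, from integration by parts on one
side and `integral_dot_pow_recurrence` on the other. The total masses fix the even moments, and the
first moments vanish. -/
lemma zonalMeasure_moments (hq : 1 ≤ q) (μ : Sph q) (m : ℕ) :
    (weightMeasure q).real Set.univ * ∫ t, t ^ m ∂(zonalMeasure μ) =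
      omega q * ∫ t, t ^ m ∂(weightMeasure q) := by
  have := isFiniteMeasure_weightMeasure hq
  have hs : ∀ m : ℕ, ∫ t, t ^ m ∂(zonalMeasure μ) = ∫ x, dot x μ ^ m ∂(sigma q) := fun m =>
    integral_zonalMeasure μ (by fun_prop)
  have hi : ∀ m : ℕ, Integrable (fun t : ℝ => t ^ m) (weightMeasure q) := fun m =>
    integrable_continuous_of_Icc (ae_weightMeasure_mem_Icc q) (continuous_pow m)
  have hrec : ∀ m : ℕ, (m + 1) * ((∫ t, t ^ m ∂(weightMeasure q)) -
      ∫ t, t ^ (m + 2) ∂(weightMeasure q)) = q * ∫ t, t ^ (m + 2) ∂(weightMeasure q) := by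
    intro m
    have h := integral_weightMeasure_derivative hq (X ^ (m + 1))
    have h2 : ∀ t : ℝ, ((1 - X ^ 2) * derivative (X ^ (m + 1)) -
        C (q : ℝ) * X * X ^ (m + 1)).eval t = (m + 1) * (t ^ m - t ^ (m + 2)) - q * t ^ (m + 2) := by
      intro t; simp; ring
    simp only [h2] at h
    have hd : Integrable (fun t : ℝ => t ^ m - t ^ (m + 2)) (weightMeasure q) := (hi m).sub (hi _)
    rw [integral_sub (hd.const_mul _) ((hi _).const_mul _), integral_const_mul,
      integral_const_mul, integral_sub (hi m) (hi _)] at h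
    linarith
  have hrec' : ∀ m : ℕ, (m + 1) * ((∫ t, t ^ m ∂(zonalMeasure μ)) -
      ∫ t, t ^ (m + 2) ∂(zonalMeasure μ)) = q * ∫ t, t ^ (m + 2) ∂(zonalMeasure μ) := by
    intro m; rw [hs, hs]; exact integral_dot_pow_recurrence hq μ m
  induction m using Nat.twoStepInduction with
  | zero =>
    simp [zonalMeasure_real_univ, mul_comm]
  | one =>
    have h := integral_weightMeasure_derivative hq 1
    have hq' : (q : ℝ) ≠ 0 := by positivity
    simp only [derivative_one, mul_zero, zero_sub, mul_one, eval_neg, eval_mul, eval_C, eval_X,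
      integral_neg] at h
    rw [integral_const_mul] at h
    have h0 : ∫ t, t ∂(weightMeasure q) = 0 := by simpa [hq'] using h
    rw [hs, integral_dot_pow_odd μ odd_one]
    simp [h0]
  | more m ih _ =>
    have h1 := hrec m
    have h2 := hrec' m
    have h3 : (0 : ℝ) < m + 1 + q := by positivity
    refine mul_left_cancel₀ h3.ne' ?_
    linear_combination (m + 1 : ℝ) * ih - (weightMeasure q).real Set.univ * h2 + omega q * h1

/-- Finite measures carried by [-1, 1] are determined by their moments. The constant drops out of
the ratios defining Gegenbauer coefficients. -/
lemma zonalMeasure_eq (hq : 1 ≤ q) (μ : Sph q) :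
    zonalMeasure μ = ENNReal.ofReal (omega q / (weightMeasure q).real Set.univ) • weightMeasure q := by
  have := isFiniteMeasure_weightMeasure hq
  have hW := weightMeasure_real_univ_pos hq
  have hω := omega_pos (q := q)
  set c := omega q / (weightMeasure q).real Set.univ with hc
  have hc0 : 0 < c := div_pos hω hW
  have : IsFiniteMeasure (ENNReal.ofReal c • weightMeasure q) :=
    Measure.smul_finite _ ENNReal.ofReal_ne_top
  have hae : ∀ᵐ t ∂(ENNReal.ofReal c • weightMeasure q), t ∈ Set.Icc (-1 : ℝ) 1 :=
    Measure.ae_smul_measure (ae_weightMeasure_mem_Icc q) _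
  have hpow : ∀ m : ℕ, ∫ t, t ^ m ∂(zonalMeasure μ) =
      ∫ t, t ^ m ∂(ENNReal.ofReal c • weightMeasure q) := by
    intro m
    rw [integral_smul_measure, ENNReal.toReal_ofReal hc0.le, smul_eq_mul, hc, div_mul_eq_mul_div,
      eq_div_iff hW.ne', ← zonalMeasure_moments hq μ m, mul_comm]
  refine ext_of_forall_integral_eq_of_IsFiniteMeasure fun f => ?_
  have := integral_mul_continuous_eq_of_polynomial (ae_zonalMeasure_mem_Icc μ) hae
    (integrable_const 1) (integrable_const 1) (fun p => ?_) f.continuous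
  · simpa using this
  · simp only [one_mul, eval_eq_sum_range]
    rw [integral_finsetSum _ fun j _ => (integrable_continuous_of_Icc (ae_zonalMeasure_mem_Icc μ)
      (continuous_pow j)).const_mul _, integral_finsetSum _ fun j _ =>
      (integrable_continuous_of_Icc hae (continuous_pow j)).const_mul _]
    simp only [integral_const_mul, hpow]

lemma gegenbauerCoeff_eq_zonalMeasure (hq : 1 ≤ q) (μ : Sph q) (f : ℝ → ℝ) (k : ℕ) :
    gegenbauerCoeff q f k = (∫ t, f t * (basisPoly q k).eval t ∂(zonalMeasure μ)) /
      ∫ t, (basisPoly q k).eval t ^ 2 ∂(zonalMeasure μ) := by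
  have hc0 : 0 < omega q / (weightMeasure q).real Set.univ :=
    div_pos omega_pos (weightMeasure_real_univ_pos hq)
  rw [zonalMeasure_eq hq, integral_smul_measure, integral_smul_measure,
    ENNReal.toReal_ofReal hc0.le, smul_eq_mul, smul_eq_mul, mul_div_mul_left _ _ hc0.ne',
    gegenbauerCoeff]

lemma integral_zonalMeasure_derivative (hq : 1 ≤ q) (μ : Sph q) (p : ℝ[X]) :
    ∫ t, ((1 - X ^ 2) * derivative p - C (q : ℝ) * X * p).eval t ∂(zonalMeasure μ) = 0 := by
  rw [zonalMeasure_eq hq, integral_smul_measure, integral_weightMeasure_derivative hq, smul_zero]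

lemma memLp_zonalMeasure (hq : 1 ≤ q) (μ : Sph q) {g : ℝ → ℝ} (hg : MemLp g 2 (weightMeasure q)) :
    MemLp g 2 (zonalMeasure μ) := by
  rw [zonalMeasure_eq hq]
  exact hg.smul_measure ENNReal.ofReal_ne_top

end Weight

/-! ### Algebraic identities for Gegenbauer polynomials. -/

section Gegenbauer

variable {α : ℝ}

lemma C_real_two : (C (2 : ℝ) : ℝ[X]) = 2 := map_ofNat C 2

lemma gegenbauer_recurrence (α : ℝ) (k : ℕ) :
    ((k : ℝ[X]) + 2) * gegenbauer α (k + 2) =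
      2 * ((k : ℝ[X]) + 1 + C α) * X * gegenbauer α (k + 1) -
        ((k : ℝ[X]) + 2 * C α) * gegenbauer α k := by
  have hk : (k : ℝ) + 2 ≠ 0 := by positivity
  have h1 : ((k : ℝ[X]) + 2) = C ((k : ℝ) + 2) := by simp [C_real_two]
  have h2 : C ((k : ℝ) + 2) * C (2 * ((k : ℝ) + 1 + α) / ((k : ℝ) + 2)) =
      (2 * ((k : ℝ[X]) + 1 + C α)) := by
    rw [← C_mul, mul_div_cancel₀ _ hk]; simp [C_real_two]
  have h3 : C ((k : ℝ) + 2) * C (((k : ℝ) + 2 * α) / ((k : ℝ) + 2)) = (k : ℝ[X]) + 2 * C α := by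
    rw [← C_mul, mul_div_cancel₀ _ hk]; simp [C_real_two]
  rw [gegenbauer, h1]
  linear_combination X * gegenbauer α (k + 1) * h2 - gegenbauer α k * h3

/-- The two relations are proved together because the induction needs both: the first, at k + 1,
comes from differentiating the recurrence, and the second is the first at k plus the recurrence. -/
lemma gegenbauer_derivative (α : ℝ) (k : ℕ) :
    (1 - X ^ 2) * derivative (gegenbauer α (k + 1)) =
        -((k : ℝ[X]) + 1) * X * gegenbauer α (k + 1) + ((k : ℝ[X]) + 2 * C α) * gegenbauer α k ∧
      (1 - X ^ 2) * derivative (gegenbauer α k) =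
        ((k : ℝ[X]) + 2 * C α) * X * gegenbauer α k - ((k : ℝ[X]) + 1) * gegenbauer α (k + 1) := by
  induction k with
  | zero =>
    constructor
    · simp [gegenbauer, C_real_two]; ring
    · simp [gegenbauer, C_real_two]
  | succ k ih =>
    obtain ⟨h1, h2⟩ := ih
    have hrec := gegenbauer_recurrence α k
    have hd := congrArg derivative hrec
    simp only [derivative_mul, derivative_sub, derivative_add, derivative_natCast, derivative_C,
      derivative_X, derivative_one, derivative_ofNat] at hd
    have hne : ((k : ℝ[X]) + 2) ≠ 0 := by
      have : (C ((k : ℝ) + 2) : ℝ[X]) ≠ 0 := C_ne_zero.2 (by positivity)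
      simpa [C_real_two] using this
    constructor
    · refine mul_left_cancel₀ hne ?_
      push_cast
      linear_combination (1 - X ^ 2) * hd + 2 * ((k : ℝ[X]) + 1 + C α) * X * h1
        - ((k : ℝ[X]) + 2 * C α) * h2
        + (k + 2) * X * hrec
    · push_cast
      linear_combination h1 + hrec

/-- Differentiate the second relation of `gegenbauer_derivative`, multiply by 1 - X², eliminate
index k + 1 with both relations, and cancel 1 - X². -/
lemma gegenbauer_ode (α : ℝ) (k : ℕ) :
    (1 - X ^ 2) * derivative (derivative (gegenbauer α k)) -
        (2 * C α + 1) * X * derivative (gegenbauer α k) =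
      -((k : ℝ[X]) * ((k : ℝ[X]) + 2 * C α)) * gegenbauer α k := by
  obtain ⟨h1, h2⟩ := gegenbauer_derivative α k
  have hd := congrArg derivative h2
  simp only [derivative_mul, derivative_sub, derivative_add, derivative_natCast, derivative_C,
      derivative_X, derivative_one, derivative_ofNat, derivative_X_pow] at hd
  have hne : (1 - X ^ 2 : ℝ[X]) ≠ 0 := fun h => by
    have := congrArg (eval 0) h
    simp at this
  refine mul_left_cancel₀ hne ?_
  simp only [map_ofNat, Nat.cast_ofNat] at hd
  linear_combination (1 - X ^ 2) * hd - (k + 1) * h1 + (k + 1) * X * h2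

lemma natDegree_C_mul_X_le' (a : ℝ) : (C a * X : ℝ[X]).natDegree ≤ 1 :=
  (natDegree_C_mul_le _ _).trans natDegree_X_le

lemma gegenbauer_degree (hα : 0 < α) (k : ℕ) :
    (gegenbauer α k).natDegree ≤ k ∧ 0 < (gegenbauer α k).coeff k := by
  induction k using Nat.twoStepInduction with
  | zero => simp [gegenbauer]
  | one =>
    refine ⟨natDegree_C_mul_X_le' _, ?_⟩
    simp only [gegenbauer, coeff_C_mul_X, if_true]; linarith
  | more k ih1 ih2 =>
    constructor
    · rw [gegenbauer]
      refine (natDegree_sub_le _ _).trans (max_le ?_ ?_)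
      · refine natDegree_mul_le.trans ?_
        have := natDegree_C_mul_X_le' (2 * ((k : ℝ) + 1 + α) / ((k : ℝ) + 2))
        omega
      · exact (natDegree_C_mul_le _ _).trans (ih1.1.trans (by omega))
    · rw [gegenbauer, coeff_sub, mul_assoc, coeff_C_mul, coeff_X_mul, coeff_C_mul,
        coeff_eq_zero_of_natDegree_lt (n := k + 2) (lt_of_le_of_lt ih1.1 (by omega)), mul_zero,
        sub_zero]
      have := ih2.2
      positivity

lemma gegenbauer_eval_one_succ (α : ℝ) (k : ℕ) :
    ((k : ℝ) + 1) * (gegenbauer α (k + 1)).eval 1 = (k + 2 * α) * (gegenbauer α k).eval 1 := by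
  have h := congrArg (eval 1) (gegenbauer_derivative α k).2
  simp only [eval_mul, eval_sub, eval_add, eval_one, eval_pow, eval_X, eval_natCast, eval_C,
    eval_ofNat, one_pow, sub_self, zero_mul, mul_one] at h
  linarith

lemma gegenbauer_eval_one (α : ℝ) (k : ℕ) :
    (gegenbauer α k).eval 1 = (ascPochhammer ℝ k).eval (2 * α) / (k.factorial : ℝ) := by
  induction k with
  | zero => simp [gegenbauer]
  | succ k ih =>
    have h := gegenbauer_eval_one_succ α k
    have hk : (k : ℝ) + 1 ≠ 0 := by positivity
    have hf : (k.factorial : ℝ) ≠ 0 := by positivity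
    rw [ih] at h
    rw [ascPochhammer_succ_eval, Nat.factorial_succ]
    push_cast
    refine mul_left_cancel₀ hk ?_
    rw [h]; field_simp; ring

end Gegenbauer

/-! ### Orthogonality and norms, uniformly in q, for an abstract functional. -/

section Basis

variable {q : ℕ}

lemma basisPoly_zero (q : ℕ) : basisPoly q 0 = 1 := by
  unfold basisPoly; split_ifs <;> simp [gegenbauer]

lemma two_mul_half_sub_one (q : ℕ) : 2 * (C (((q : ℝ) - 1) / 2) : ℝ[X]) = q - 1 := by
  rw [← C_real_two, ← C_mul, mul_div_cancel₀ _ two_ne_zero]; simp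

lemma basisPoly_ode (q k : ℕ) :
    (1 - X ^ 2) * derivative (derivative (basisPoly q k)) -
        C (q : ℝ) * X * derivative (basisPoly q k) =
      -C ((k : ℝ) * (k + q - 1)) * basisPoly q k := by
  unfold basisPoly
  split_ifs with h
  · subst h
    have := Chebyshev.one_sub_X_sq_mul_derivative_derivative_T_eq_poly_in_T (R := ℝ) (k : ℤ)
    simp only [Function.iterate_succ, Function.iterate_zero, Function.comp, id] at this
    rw [this]
    simp only [Nat.cast_one, C_1, one_mul, add_sub_cancel_right, C_mul, map_natCast,
      Int.cast_natCast]
    ring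
  · have := gegenbauer_ode (((q : ℝ) - 1) / 2) k
    rw [two_mul_half_sub_one] at this
    simp only [C_mul, C_add, C_sub, C_1, map_natCast] at *
    linear_combination this

lemma basisPoly_natDegree (hq : 1 ≤ q) (k : ℕ) : (basisPoly q k).natDegree = k := by
  unfold basisPoly
  split_ifs with h
  · simp [Chebyshev.natDegree_T]
  · have hq2 : (2 : ℝ) ≤ q := by exact_mod_cast (show 2 ≤ q by omega)
    obtain ⟨h1, h2⟩ := gegenbauer_degree (α := ((q : ℝ) - 1) / 2) (by linarith) k
    exact le_antisymm h1 (le_natDegree_of_ne_zero h2.ne')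

lemma basisPoly_eval_one_pos (hq : 1 ≤ q) (k : ℕ) : 0 < (basisPoly q k).eval 1 := by
  unfold basisPoly
  split_ifs with h
  · simp
  · have hq2 : (2 : ℝ) ≤ q := by exact_mod_cast (show 2 ≤ q by omega)
    rw [gegenbauer_eval_one]
    have := ascPochhammer_pos k (2 * (((q : ℝ) - 1) / 2)) (by linarith)
    positivity

lemma basisPoly_ne_zero (hq : 1 ≤ q) (k : ℕ) : basisPoly q k ≠ 0 := fun h => by
  simpa [h] using basisPoly_eval_one_pos hq k

variable {I : ℝ[X] →ₗ[ℝ] ℝ}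

/-- Sturm–Liouville argument: applied to the Wronskian, `hI` gives the difference of the eigenvalues
k(k + q - 1) and j(j + q - 1) times the pairing, and that difference factors as (k - j)(k + j + q -
1) ≠ 0. -/
lemma basisPoly_orthogonal (hq : 1 ≤ q)
    (hI : ∀ p, I ((1 - X ^ 2) * derivative p - C (q : ℝ) * X * p) = 0) {j k : ℕ} (hjk : j ≠ k) :
    I (basisPoly q j * basisPoly q k) = 0 := by
  have h := hI (derivative (basisPoly q j) * basisPoly q k -
    derivative (basisPoly q k) * basisPoly q j)
  have hj := basisPoly_ode q j
  have hk := basisPoly_ode q k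
  have e : (1 - X ^ 2) * derivative (derivative (basisPoly q j) * basisPoly q k -
      derivative (basisPoly q k) * basisPoly q j) - C (q : ℝ) * X *
      (derivative (basisPoly q j) * basisPoly q k - derivative (basisPoly q k) * basisPoly q j) =
      ((k : ℝ) * (k + q - 1) - j * (j + q - 1)) • (basisPoly q j * basisPoly q k) := by
    rw [smul_eq_C_mul, C_sub, derivative_sub, derivative_mul, derivative_mul]
    linear_combination basisPoly q k * hj - basisPoly q j * hk
  rw [e, map_smul, smul_eq_mul] at h
  refine (mul_eq_zero.1 h).resolve_left ?_
  have h1 : (k : ℝ) * (k + q - 1) - j * (j + q - 1) = (k - j) * (k + j + q - 1) := by ring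
  rw [h1]
  have hq' : (1 : ℝ) ≤ q := by exact_mod_cast hq
  have h2 : (1 : ℝ) ≤ k + j := by exact_mod_cast (show 1 ≤ k + j by omega)
  refine mul_ne_zero (sub_ne_zero.2 fun h => hjk ?_) (by linarith)
  exact_mod_cast h.symm

/-- The k-th basis polynomial has degree exactly k, so the top coefficient can be removed one degree
at a time. -/
lemma linearMap_eq_zero_of_basisPoly (hq : 1 ≤ q) (J : ℝ[X] →ₗ[ℝ] ℝ) (n : ℕ)
    (hJ : ∀ j ≤ n, J (basisPoly q j) = 0) (p : ℝ[X]) (hp : p.natDegree ≤ n) : J p = 0 := by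
  induction n using Nat.strong_induction_on generalizing p with
  | _ n ih =>
    set a := p.coeff n / (basisPoly q n).coeff n with ha
    have hlc : (basisPoly q n).coeff n ≠ 0 := by
      have := leadingCoeff_ne_zero.2 (basisPoly_ne_zero hq n)
      rwa [leadingCoeff, basisPoly_natDegree hq] at this
    have hr : J (p - C a * basisPoly q n) = 0 := by
      have hle : (p - C a * basisPoly q n).natDegree ≤ n :=
        (natDegree_sub_le _ _).trans (max_le hp
          ((natDegree_C_mul_le _ _).trans (basisPoly_natDegree hq n).le))
      have hc : (p - C a * basisPoly q n).coeff n = 0 := by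
        rw [coeff_sub, coeff_C_mul, ha, div_mul_cancel₀ _ hlc, sub_self]
      rcases Nat.eq_zero_or_pos n with rfl | hpos
      · rw [eq_C_of_natDegree_le_zero hle, hc]; simp
      · exact ih (n - 1) (by omega) (fun j hj => hJ j (by omega)) _ (natDegree_le_pred hle hc)
    rw [map_sub, ← smul_eq_C_mul, map_smul, hJ n le_rfl, smul_zero, sub_zero] at hr
    exact hr

lemma basisPoly_orthogonal_of_natDegree_lt (hq : 1 ≤ q)
    (hI : ∀ p, I ((1 - X ^ 2) * derivative p - C (q : ℝ) * X * p) = 0) {k : ℕ} {p : ℝ[X]}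
    (hp : p.natDegree < k) : I (p * basisPoly q k) = 0 :=
  linearMap_eq_zero_of_basisPoly hq (I ∘ₗ LinearMap.mulRight ℝ (basisPoly q k)) p.natDegree
    (fun j hj => basisPoly_orthogonal hq hI (by omega)) p le_rfl

/-- Pairing the recurrence with its highest and with its lowest term expresses consecutive norms
through the same mixed integral of X C_k C_{k+1}; the resulting ratio matches that of the values at
1. -/
lemma gegenbauer_norm {α : ℝ}
    (horth : ∀ j k, j ≠ k → I (gegenbauer α j * gegenbauer α k) = 0) (k : ℕ) :
    (k + α) * I (gegenbauer α k ^ 2) = α * (gegenbauer α k).eval 1 * I 1 := by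
  have hA : ∀ k : ℕ, ((k : ℝ) + 1) * I (gegenbauer α (k + 1) ^ 2) =
      2 * (k + α) * I (X * gegenbauer α k * gegenbauer α (k + 1)) := by
    intro k
    rcases k with _ | k
    -- The recurrence starts at index 2, so C₁ = 2αX is treated directly.
    · have : gegenbauer α (0 + 1) ^ 2 = (2 * α) • (X * gegenbauer α 0 * gegenbauer α (0 + 1)) := by
        rw [smul_eq_C_mul]; simp [gegenbauer]; ring
      rw [this, map_smul]; simp
    · have h := congrArg (fun p => I (p * gegenbauer α (k + 2))) (gegenbauer_recurrence α k)
      have e1 : ((k : ℝ[X]) + 2) * gegenbauer α (k + 2) * gegenbauer α (k + 2) =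
          ((k : ℝ) + 2) • gegenbauer α (k + 2) ^ 2 := by
        rw [smul_eq_C_mul]; simp [C_real_two]; ring
      have e2 : (2 * ((k : ℝ[X]) + 1 + C α) * X * gegenbauer α (k + 1) -
          ((k : ℝ[X]) + 2 * C α) * gegenbauer α k) *
          gegenbauer α (k + 2) =
          (2 * ((k : ℝ) + 1 + α)) • (X * gegenbauer α (k + 1) * gegenbauer α (k + 2)) -
          ((k : ℝ) + 2 * α) • (gegenbauer α k * gegenbauer α (k + 2)) := by
        rw [smul_eq_C_mul, smul_eq_C_mul]; simp [C_real_two]; ring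
      simp only [e1, e2, map_smul, map_sub, smul_eq_mul, horth k (k + 2) (by omega)] at h
      push_cast
      linear_combination h
  have hB : ∀ k : ℕ, 2 * (k + 1 + α) * I (X * gegenbauer α k * gegenbauer α (k + 1)) =
      (k + 2 * α) * I (gegenbauer α k ^ 2) := by
    intro k
    have h := congrArg (fun p => I (p * gegenbauer α k)) (gegenbauer_recurrence α k)
    have e1 : ((k : ℝ[X]) + 2) * gegenbauer α (k + 2) * gegenbauer α k =
        ((k : ℝ) + 2) • (gegenbauer α (k + 2) * gegenbauer α k) := by
      rw [smul_eq_C_mul]; simp [C_real_two]; ring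
    have e2 : (2 * ((k : ℝ[X]) + 1 + C α) * X * gegenbauer α (k + 1) -
          ((k : ℝ[X]) + 2 * C α) * gegenbauer α k) *
        gegenbauer α k =
        (2 * ((k : ℝ) + 1 + α)) • (X * gegenbauer α k * gegenbauer α (k + 1)) -
        ((k : ℝ) + 2 * α) • (gegenbauer α k ^ 2) := by
      rw [smul_eq_C_mul, smul_eq_C_mul]; simp [C_real_two]; ring
    simp only [e1, e2, map_smul, map_sub, smul_eq_mul, horth (k + 2) k (by omega)] at h
    linear_combination -h
  induction k with
  | zero => simp [gegenbauer]
  | succ k ih =>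
    have h1 := gegenbauer_eval_one_succ α k
    have hk : (k : ℝ) + 1 ≠ 0 := by positivity
    refine mul_left_cancel₀ hk ?_
    push_cast
    linear_combination (k + 1 + α) * hA k + (k + α) * hB k + (k + 2 * α) * ih - α * I 1 * h1

/-- The squared form is the one in which `tau` appears for every q: for q ≥ 2 its Pochhammer factor
is the value at 1, and one such value remains on the right to meet the Funk–Hecke denominator. -/
lemma basisPoly_norm (hq : 1 ≤ q)
    (hI : ∀ p, I ((1 - X ^ 2) * derivative p - C (q : ℝ) * X * p) = 0) (k : ℕ) :
    I (basisPoly q k ^ 2) ^ 2 = tau q k * (basisPoly q k).eval 1 * I 1 ^ 2 := by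
  have horth := fun j k (h : j ≠ k) => basisPoly_orthogonal hq hI h
  by_cases h : q = 1
  · subst h
    simp only [basisPoly, if_true, tau] at *
    rcases Nat.eq_zero_or_pos k with rfl | hk
    · norm_num
    · have h2 := Chebyshev.T_mul_T ℝ (k : ℤ) k
      have h3 := horth 0 (2 * k) (by omega)
      -- The double-angle formula; for k > 0 the term T₀ T_{2k} is killed by orthogonality, leaving
      -- half the total mass.
      have h4 : Chebyshev.T ℝ (k : ℤ) ^ 2 = (1 / 2 : ℝ) •
          (Chebyshev.T ℝ ((0 : ℕ) : ℤ) * Chebyshev.T ℝ ((2 * k : ℕ) : ℤ) + 1) := by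
        have e : (((2 * k : ℕ) : ℤ)) = (k : ℤ) + k := by push_cast; ring
        rw [sub_self, Chebyshev.T_zero, ← e] at h2
        have h5 : (2 : ℝ) • Chebyshev.T ℝ (k : ℤ) ^ 2 = Chebyshev.T ℝ ((0 : ℕ) : ℤ) *
            Chebyshev.T ℝ ((2 * k : ℕ) : ℤ) + 1 := by
          rw [smul_eq_C_mul, Nat.cast_zero, Chebyshev.T_zero, one_mul, ← h2, C_real_two]; ring
        rw [← h5, smul_smul]; norm_num
      rw [h4, map_smul, map_add, h3, Chebyshev.T_eval_one, if_neg hk.ne']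
      simp only [smul_eq_mul]; ring
  · have hq2 : (2 : ℝ) ≤ q := by exact_mod_cast (show 2 ≤ q by omega)
    simp only [basisPoly, if_neg h, tau] at *
    have hn := gegenbauer_norm horth k
    have he : (ascPochhammer ℝ k).eval ((q : ℝ) - 1) / (k.factorial : ℝ) =
        (gegenbauer (((q : ℝ) - 1) / 2) k).eval 1 := by
      rw [gegenbauer_eval_one, mul_div_cancel₀ _ two_ne_zero]
    rw [he]
    have h1 : (q : ℝ) - 1 ≠ 0 := by linarith
    have h2 : (q : ℝ) - 1 + 2 * k ≠ 0 := by
      have : (0 : ℝ) ≤ k := k.cast_nonneg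
      linarith
    have h3 : I (gegenbauer (((q : ℝ) - 1) / 2) k ^ 2) = (1 + 2 * (k : ℝ) / ((q : ℝ) - 1))⁻¹ *
        (gegenbauer (((q : ℝ) - 1) / 2) k).eval 1 * I 1 := by
      have : 1 + 2 * (k : ℝ) / ((q : ℝ) - 1) = ((q : ℝ) - 1 + 2 * k) / (q - 1) := by field_simp
      rw [this, inv_div]
      field_simp
      linear_combination 2 * hn
    rw [h3, zpow_neg, zpow_ofNat, mul_pow, mul_pow, inv_pow]
    ring

end Basis

/-! ### Zonal integral operators and their eigenvalues. -/

section FunkHecke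

variable {q : ℕ}

/-- Integration of polynomials against the zonal measure. -/
def zonalIntegral (μ : Sph q) : ℝ[X] →ₗ[ℝ] ℝ where
  toFun p := ∫ t, p.eval t ∂(zonalMeasure μ)
  map_add' p r := by
    simp only [eval_add]
    exact integral_add (integrable_continuous_of_Icc (ae_zonalMeasure_mem_Icc μ) p.continuous)
      (integrable_continuous_of_Icc (ae_zonalMeasure_mem_Icc μ) r.continuous)
  map_smul' c p := by
    simp only [eval_smul, smul_eq_mul, integral_const_mul, RingHom.id_apply]

lemma zonalIntegral_apply (μ : Sph q) (p : ℝ[X]) :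
    zonalIntegral μ p = ∫ t, p.eval t ∂(zonalMeasure μ) := rfl

lemma zonalIntegral_eq_integral_sphere (μ : Sph q) (p : ℝ[X]) :
    zonalIntegral μ p = ∫ x, p.eval (dot x μ) ∂(sigma q) :=
  integral_zonalMeasure_polynomial μ p

lemma zonalIntegral_derivative (hq : 1 ≤ q) (μ : Sph q) (p : ℝ[X]) :
    zonalIntegral μ ((1 - X ^ 2) * derivative p - C (q : ℝ) * X * p) = 0 :=
  integral_zonalMeasure_derivative hq μ p

lemma zonalIntegral_one (μ : Sph q) : zonalIntegral μ 1 = omega q := by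
  simp [zonalIntegral_apply, zonalMeasure_real_univ]

instance : (sigma q).IsOpenPosMeasure := by unfold sigma; infer_instance

/-- A continuous nonnegative function of zero integral vanishes everywhere, as the surface measure
charges open sets; an isometry then changes the pole. -/
lemma eval_dot_eq_zero_of_zonalIntegral_sq {μ : Sph q} {p : ℝ[X]}
    (h : zonalIntegral μ (p ^ 2) = 0) (x μ' : Sph q) : p.eval (dot x μ') = 0 := by
  have hc : Continuous fun x : Sph q => p.eval (dot x μ) ^ 2 :=
    (p.continuous.comp (continuous_dot_left μ)).pow 2
  rw [zonalIntegral_eq_integral_sphere] at h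
  simp only [eval_pow] at h
  rw [integral_eq_zero_iff_of_nonneg (fun _ => sq_nonneg _) (integrable_of_continuous hc)] at h
  have h1 := (Continuous.ae_eq_iff_eq (sigma q) hc continuous_const).1 h
  obtain ⟨R, -, hR⟩ := exists_isometry_map_pair (x := μ') (μ := μ') (x' := μ) (μ' := μ)
    (by rw [dot_self, dot_self])
  have h2 := congrFun h1 (sphMap R x)
  rw [← dot_sphMap R, hR]
  exact pow_eq_zero_iff two_ne_zero |>.1 h2

lemma exists_bound_comp_dot {K : ℝ → ℝ} (hK : Continuous K) :
    ∃ M, ∀ x y : Sph q, ‖K (dot x y)‖ ≤ M := by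
  obtain ⟨C, hC⟩ := (isCompact_Icc (a := (-1 : ℝ)) (b := 1)).exists_bound_of_continuousOn
    hK.continuousOn
  exact ⟨C, fun x y => hC _ (dot_mem_Icc x y)⟩

lemma integrable_kernel_mul_prod {K : ℝ → ℝ} (hK : Continuous K) {F G : Sph q → ℝ}
    (hF : Integrable F (sigma q)) (hG : Integrable G (sigma q)) :
    Integrable (fun p : Sph q × Sph q => F p.1 * G p.2 * K (dot p.1 p.2))
      ((sigma q).prod (sigma q)) := by
  obtain ⟨M, hM⟩ := exists_bound_comp_dot (q := q) hK
  exact (hF.mul_prod hG).mul_bdd (c := M) (hK.comp continuous_dot).aestronglyMeasurable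
    (Filter.Eventually.of_forall fun p => hM p.1 p.2)

/-- Self-adjointness of the kernel operator: Fubini and the symmetry of the scalar product. -/
lemma integral_kernel_swap {K : ℝ → ℝ} (hK : Continuous K) {F G : Sph q → ℝ}
    (hF : Integrable F (sigma q)) (hG : Integrable G (sigma q)) :
    ∫ x, F x * ∫ y, K (dot x y) * G y ∂(sigma q) ∂(sigma q) =
      ∫ y, G y * ∫ x, K (dot y x) * F x ∂(sigma q) ∂(sigma q) := by
  simp only [← integral_const_mul]
  rw [integral_integral_swap]
  · refine integral_congr_ae (Filter.Eventually.of_forall fun y => ?_)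
    refine integral_congr_ae (Filter.Eventually.of_forall fun x => ?_)
    simp only [dot_comm y x]; ring
  · refine (integrable_kernel_mul_prod hK hF hG).congr (Filter.Eventually.of_forall fun p => ?_)
    simp only [Function.uncurry]; ring

lemma integrable_polynomial_dot (p : ℝ[X]) (μ : Sph q) :
    Integrable (fun x => p.eval (dot x μ)) (sigma q) :=
  integrable_of_continuous (p.continuous.comp (continuous_dot_left μ))

/-- The Funk-Hecke formula. -/
theorem exists_funk_hecke (hq : 1 ≤ q) {K : ℝ → ℝ} (hK : Continuous K) (k : ℕ) :
    ∃ c : ℝ, ∀ x μ : Sph q, ∫ y, K (dot x y) * (basisPoly q k).eval (dot y μ) ∂(sigma q) =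
      c * (basisPoly q k).eval (dot x μ) := by
  obtain ⟨Q, hQd, hQ⟩ := exists_polynomial_integral_kernel hq hK (basisPoly q k)
  let μ : Sph q := basisPoint 0
  have hI := zonalIntegral_derivative hq μ
  set a := Q.coeff k / (basisPoly q k).coeff k with ha
  have hlc : (basisPoly q k).coeff k ≠ 0 := by
    have := leadingCoeff_ne_zero.2 (basisPoly_ne_zero hq k)
    rwa [leadingCoeff, basisPoly_natDegree hq] at this
  rw [basisPoly_natDegree hq] at hQd
  set R := Q - C a * basisPoly q k with hR
  have hle : R.natDegree ≤ k := (natDegree_sub_le _ _).trans (max_le hQd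
    ((natDegree_C_mul_le _ _).trans (basisPoly_natDegree hq k).le))
  have hc : R.coeff k = 0 := by
    rw [hR, coeff_sub, coeff_C_mul, ha, div_mul_cancel₀ _ hlc, sub_self]
  -- `R` has degree below k, as does its image `S`. Hence ⟨R, Q⟩ = ⟨S, P_k⟩ = 0 by self-adjointness,
  -- and ⟨R, P_k⟩ = 0, so ⟨R, R⟩ = 0.
  have hzero : zonalIntegral μ (R ^ 2) = 0 := by
    by_cases hR0 : R = 0
    · simp [hR0]
    have hlt : R.natDegree < k := lt_of_le_of_ne hle fun h => by
      rw [← h] at hc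
      exact hR0 (leadingCoeff_eq_zero.1 hc)
    obtain ⟨S, hSd, hS⟩ := exists_polynomial_integral_kernel hq hK R
    have h1 : zonalIntegral μ (R * Q) = zonalIntegral μ (S * basisPoly q k) := by
      rw [zonalIntegral_eq_integral_sphere, zonalIntegral_eq_integral_sphere]
      simp only [eval_mul, ← hQ, ← hS]
      rw [integral_kernel_swap hK (integrable_polynomial_dot R μ)
        (integrable_polynomial_dot (basisPoly q k) μ)]
      simp only [mul_comm]
    rw [basisPoly_orthogonal_of_natDegree_lt hq hI (hSd.trans_lt hlt)] at h1
    have h2 : R ^ 2 = R * Q - a • (R * basisPoly q k) := by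
      rw [smul_eq_C_mul, hR]; ring
    rw [h2, map_sub, map_smul, h1, basisPoly_orthogonal_of_natDegree_lt hq hI hlt]
    simp
  refine ⟨a, fun x μ' => ?_⟩
  have := eval_dot_eq_zero_of_zonalIntegral_sq hzero x μ'
  rw [hR, eval_sub, eval_mul, eval_C, sub_eq_zero] at this
  rw [hQ, this]

theorem funk_hecke (hq : 1 ≤ q) {K : ℝ → ℝ} (hK : Continuous K) (k : ℕ) (x μ : Sph q) :
    ∫ y, K (dot x y) * (basisPoly q k).eval (dot y μ) ∂(sigma q) =
      (∫ t, K t * (basisPoly q k).eval t ∂(zonalMeasure μ)) / (basisPoly q k).eval 1 *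
        (basisPoly q k).eval (dot x μ) := by
  obtain ⟨c, hc⟩ := exists_funk_hecke hq hK k
  -- At the pole the left side becomes a zonal integral, which determines the eigenvalue.
  have h := hc μ μ
  rw [dot_self] at h
  have hKP : Continuous fun t => K t * (basisPoly q k).eval t := hK.mul (basisPoly q k).continuous
  rw [integral_zonalMeasure μ hKP.aestronglyMeasurable, hc]
  simp only [dot_comm μ] at h
  rw [h, mul_div_cancel_right₀ _ (basisPoly_eval_one_pos hq k).ne']

end FunkHecke

/-! ### Hilbert basis and series for the energy. -/

section Expansion

variable {q : ℕ}

/-- The squared norm of the basis polynomial in the zonal measure. -/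
def sqNorm (μ : Sph q) (k : ℕ) : ℝ := zonalIntegral μ (basisPoly q k ^ 2)

lemma sqNorm_pos (hq : 1 ≤ q) (μ : Sph q) (k : ℕ) : 0 < sqNorm μ k := by
  refine lt_of_le_of_ne ?_ fun h => ?_
  · rw [sqNorm, zonalIntegral_apply]
    exact integral_nonneg fun t => by simp only [eval_pow]; positivity
  · have := eval_dot_eq_zero_of_zonalIntegral_sq h.symm μ μ
    rw [dot_self] at this
    exact (basisPoly_eval_one_pos hq k).ne' this

lemma memLp_polynomial (μ : Sph q) (p : ℝ[X]) :
    MemLp (fun t => p.eval t) 2 (zonalMeasure μ) := by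
  obtain ⟨C, hC⟩ := (isCompact_Icc (a := (-1 : ℝ)) (b := 1)).exists_bound_of_continuousOn
    p.continuous.continuousOn
  exact MemLp.of_bound p.continuous.aestronglyMeasurable C ((ae_zonalMeasure_mem_Icc μ).mono hC)

/-- The normalized basis polynomials in `L²` of the zonal measure. -/
def basisLp (μ : Sph q) (k : ℕ) : Lp ℝ 2 (zonalMeasure μ) :=
  (√(sqNorm μ k))⁻¹ • (memLp_polynomial μ (basisPoly q k)).toLp _

lemma inner_toLp_polynomial (μ : Sph q) (p : ℝ[X]) (f : Lp ℝ 2 (zonalMeasure μ)) :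
    inner ℝ ((memLp_polynomial μ p).toLp _) f = ∫ t, f t * p.eval t ∂(zonalMeasure μ) := by
  rw [L2.inner_def]
  refine integral_congr_ae ?_
  filter_upwards [(memLp_polynomial μ p).coeFn_toLp] with t ht
  simp [ht]

lemma orthonormal_basisLp (hq : 1 ≤ q) (μ : Sph q) : Orthonormal ℝ (basisLp μ) := by
  have h : ∀ j k, inner ℝ ((memLp_polynomial μ (basisPoly q j)).toLp _)
      ((memLp_polynomial μ (basisPoly q k)).toLp _) =
      zonalIntegral μ (basisPoly q k * basisPoly q j) := by
    intro j k
    rw [inner_toLp_polynomial, zonalIntegral_apply]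
    refine integral_congr_ae ?_
    filter_upwards [(memLp_polynomial μ (basisPoly q k)).coeFn_toLp] with t ht
    rw [ht, eval_mul]
  rw [orthonormal_iff_ite]
  intro j k
  rw [basisLp, basisLp, real_inner_smul_left, real_inner_smul_right, h]
  split_ifs with hjk
  · subst hjk
    have := sqNorm_pos hq μ j
    rw [← sq (basisPoly q j)]
    change _ * (_ * sqNorm μ j) = 1
    have h2 := Real.mul_self_sqrt this.le
    have h3 : √(sqNorm μ j) ≠ 0 := (Real.sqrt_pos.2 this).ne'
    field_simp
    rw [sq, h2]
  · rw [basisPoly_orthogonal hq (zonalIntegral_derivative hq μ) (Ne.symm hjk)]; simp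

/-- A function orthogonal to the basis is orthogonal to all polynomials, hence by density to
continuous functions, in particular to smooth test functions, so it is zero. -/
lemma span_basisLp_orthogonal (hq : 1 ≤ q) (μ : Sph q) :
    (Submodule.span ℝ (Set.range (basisLp μ)))ᗮ = ⊥ := by
  rw [Submodule.eq_bot_iff]
  intro f hf
  have hfi : Integrable f (zonalMeasure μ) := (Lp.memLp f).integrable (by norm_num)
  have hm := ae_zonalMeasure_mem_Icc μ
  let J : ℝ[X] →ₗ[ℝ] ℝ :=
    { toFun := fun p => ∫ t, f t * p.eval t ∂(zonalMeasure μ)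
      map_add' := fun p r => by
        simp only [eval_add, mul_add]
        exact integral_add (integrable_mul_continuous_of_Icc hm hfi p.continuous)
          (integrable_mul_continuous_of_Icc hm hfi r.continuous)
      map_smul' := fun c p => by
        simp only [eval_smul, smul_eq_mul, mul_left_comm _ c, integral_const_mul,
          RingHom.id_apply] }
  have hJ : ∀ k, J (basisPoly q k) = 0 := by
    intro k
    have h1 := (Submodule.mem_orthogonal _ _).1 hf (basisLp μ k)
      (Submodule.subset_span ⟨k, rfl⟩)
    rw [basisLp, real_inner_smul_left, inner_toLp_polynomial] at h1
    exact (mul_eq_zero.1 h1).resolve_left (inv_ne_zero (Real.sqrt_pos.2 (sqNorm_pos hq μ k)).ne')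
  have hpoly : ∀ p : ℝ[X], ∫ t, f t * p.eval t ∂(zonalMeasure μ) =
      ∫ t, (0 : ℝ → ℝ) t * p.eval t ∂(zonalMeasure μ) := by
    intro p
    simp only [Pi.zero_apply, zero_mul, integral_zero]
    exact linearMap_eq_zero_of_basisPoly hq J p.natDegree (fun j _ => hJ j) p le_rfl
  rw [Lp.eq_zero_iff_ae_eq_zero]
  refine ae_eq_zero_of_integral_contDiff_smul_eq_zero hfi.locallyIntegrable fun φ hφ _ => ?_
  have := integral_mul_continuous_eq_of_polynomial hm hm hfi (integrable_zero _ _ _) hpoly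
    hφ.continuous
  simp only [Pi.zero_apply, zero_mul, integral_zero] at this
  simpa [mul_comm] using this

/-- The Hilbert basis of normalized basis polynomials. -/
def basisHilbert (hq : 1 ≤ q) (μ : Sph q) : HilbertBasis ℕ ℝ (Lp ℝ 2 (zonalMeasure μ)) :=
  HilbertBasis.mkOfOrthogonalEqBot (orthonormal_basisLp hq μ) (span_basisLp_orthogonal hq μ)

lemma aestronglyMeasurable_kernel_integral {K : ℝ → ℝ} (hK : Continuous K) {F : Sph q → ℝ}
    (hF : Integrable F (sigma q)) :
    AEStronglyMeasurable (fun y => ∫ x, K (dot y x) * F x ∂(sigma q)) (sigma q) := by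
  have h := (integrable_kernel_mul_prod hK (integrable_const (1 : ℝ)) hF)
  refine (h.integral_prod_left.aestronglyMeasurable).congr (Filter.Eventually.of_forall fun y => ?_)
  simp only [one_mul]
  exact integral_congr_ae (Filter.Eventually.of_forall fun x => mul_comm _ _)

/-- The image is bounded because the kernel is, so pairing with it is continuous on `L²`. -/
lemma memLp_kernel_integral {K : ℝ → ℝ} (hK : Continuous K) {F : Sph q → ℝ}
    (hF : Integrable F (sigma q)) :
    MemLp (fun y => ∫ x, K (dot y x) * F x ∂(sigma q)) 2 (sigma q) := by
  obtain ⟨M, hM⟩ := exists_bound_comp_dot (q := q) hK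
  refine MemLp.of_bound (aestronglyMeasurable_kernel_integral hK hF) (∫ x, M * ‖F x‖ ∂(sigma q))
    (Filter.Eventually.of_forall fun y => ?_)
  refine norm_integral_le_of_norm_le (hF.norm.const_mul M) (Filter.Eventually.of_forall fun x => ?_)
  rw [norm_mul]
  exact mul_le_mul_of_nonneg_right (hM y x) (norm_nonneg _)

/-- Freeze one copy of g inside the kernel integral and expand only the other; convergence in `L²`
passes through a continuous functional, so the expansion of K itself need not converge pointwise. -/
theorem hasSum_kernel_energy (hq : 1 ≤ q) {K : ℝ → ℝ} (hK : Continuous K) (μ : Sph q)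
    {g : ℝ → ℝ} (hg : MemLp g 2 (weightMeasure q)) :
    HasSum (fun k => omega q ^ 2 * (tau q k * gegenbauerCoeff q K k * gegenbauerCoeff q g k ^ 2))
      (∫ y, g (dot y μ) * ∫ x, K (dot y x) * g (dot x μ) ∂(sigma q) ∂(sigma q)) := by
  have hgz := memLp_zonalMeasure hq μ hg
  have hmp := measurePreserving_dot μ
  have hgs : Integrable (fun x => g (dot x μ)) (sigma q) :=
    (hgz.comp_measurePreserving hmp).integrable (by norm_num)
  have hH := memLp_kernel_integral hK hgs
  -- Lift a profile isometrically to the sphere, then pair it with the image of g under the kernel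
  -- operator.
  let Λ : Lp ℝ 2 (zonalMeasure μ) →L[ℝ] ℝ :=
    (innerSL ℝ (hH.toLp _)).comp
      (Lp.compMeasurePreservingₗᵢ ℝ (fun x => dot x μ) hmp).toContinuousLinearMap
  have hΛ : ∀ {f : ℝ → ℝ} (hf : MemLp f 2 (zonalMeasure μ)), Λ (hf.toLp f) =
      ∫ y, f (dot y μ) * ∫ x, K (dot y x) * g (dot x μ) ∂(sigma q) ∂(sigma q) := by
    intro f hf
    change inner ℝ (hH.toLp _) (Lp.compMeasurePreserving _ hmp (hf.toLp f)) = _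
    rw [Lp.toLp_compMeasurePreserving hf hmp, L2.inner_def]
    refine integral_congr_ae ?_
    filter_upwards [hH.coeFn_toLp, (hf.comp_measurePreserving hmp).coeFn_toLp] with y h1 h2
    simp [h1, h2]
  have hsum := ((basisHilbert hq μ).hasSum_repr (hgz.toLp g)).mapL Λ
  rw [hΛ hgz] at hsum
  convert hsum using 1
  funext k
  set P := basisPoly q k with hP
  set A := ∫ t, g t * P.eval t ∂(zonalMeasure μ) with hA
  set B := ∫ t, K t * P.eval t ∂(zonalMeasure μ) with hB
  have hr : (basisHilbert hq μ).repr (hgz.toLp g) k = (√(sqNorm μ k))⁻¹ * A := by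
    rw [HilbertBasis.repr_apply_apply, basisHilbert, HilbertBasis.coe_mkOfOrthogonalEqBot, basisLp,
      real_inner_smul_left, inner_toLp_polynomial]
    congr 1
    refine integral_congr_ae ?_
    filter_upwards [hgz.coeFn_toLp] with t ht
    rw [ht]
  -- Self-adjointness moves the operator onto the basis polynomial, where Funk–Hecke applies.
  have hv : Λ (basisHilbert hq μ k) = (√(sqNorm μ k))⁻¹ * (B / P.eval 1 * A) := by
    rw [basisHilbert, HilbertBasis.coe_mkOfOrthogonalEqBot, basisLp, map_smul, hΛ, smul_eq_mul,
      integral_kernel_swap hK (integrable_polynomial_dot _ μ) hgs]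
    simp only [funk_hecke hq hK, mul_left_comm _ (_ / _), integral_const_mul]
    have hgP : AEStronglyMeasurable (fun t => g t * P.eval t) (zonalMeasure μ) :=
      hgz.1.mul P.continuous.aestronglyMeasurable
    rw [hA, integral_zonalMeasure μ hgP]
  have hh := sqNorm_pos hq μ k
  have hnorm : sqNorm μ k ^ 2 = tau q k * P.eval 1 * omega q ^ 2 := by
    rw [sqNorm, basisPoly_norm hq (zonalIntegral_derivative hq μ), zonalIntegral_one]
  have hP1 : P.eval 1 ≠ 0 := (basisPoly_eval_one_pos hq k).ne'
  have hden : ∫ t, P.eval t ^ 2 ∂(zonalMeasure μ) = sqNorm μ k := by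
    rw [sqNorm, zonalIntegral_apply]; simp only [eval_pow, hP]
  rw [map_smul, hr, hv, smul_eq_mul, gegenbauerCoeff_eq_zonalMeasure hq μ,
    gegenbauerCoeff_eq_zonalMeasure hq μ, ← hP, ← hA, ← hB, hden]
  have e1 : (√(sqNorm μ k))⁻¹ * A * ((√(sqNorm μ k))⁻¹ * (B / P.eval 1 * A)) =
      (√(sqNorm μ k) * √(sqNorm μ k))⁻¹ * (B / P.eval 1 * A ^ 2) := by
    rw [mul_inv]; ring
  rw [e1, Real.mul_self_sqrt hh.le]
  have e2 : omega q ^ 2 * (tau q k * (B / sqNorm μ k) * (A / sqNorm μ k) ^ 2) =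
      (tau q k * P.eval 1 * omega q ^ 2) * (B * A ^ 2 / (P.eval 1 * sqNorm μ k ^ 3)) := by
    field_simp
  rw [e2, ← hnorm]
  field_simp

end Expansion

/-! ### Null mean and expectations over independent pairs. -/

section Probability

variable {q : ℕ}

lemma continuous_smoothMaxKernel (κ : ℝ) : Continuous (smoothMaxKernel κ) := by
  unfold smoothMaxKernel; fun_prop

lemma continuous_poissonKernel (q : ℕ) {ρ : ℝ} (h0 : 0 < ρ) (h1 : ρ < 1) :
    Continuous (poissonKernel q ρ) := by
  have hpos : ∀ θ : ℝ, 0 < 1 - 2 * ρ * Real.cos θ + ρ ^ 2 := fun θ => by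
    nlinarith [Real.cos_le_one θ, sq_pos_of_pos (sub_pos.2 h1)]
  unfold poissonKernel
  refine continuous_const.div (Continuous.rpow_const (by fun_prop) fun θ => Or.inl (hpos θ).ne')
    fun θ => (Real.rpow_pos_of_pos (hpos θ) _).ne'

/-- By rotation invariance the inner integral is the same for every first point, namely the zonal
average of the kernel. -/
lemma nullMean_eq (hq : 1 ≤ q) {ψ : ℝ → ℝ} (hψ : Continuous ψ) :
    nullMean q ψ = kernelCoeff q ψ 0 := by
  have hK : Continuous fun t => ψ (Real.arccos t) := hψ.comp Real.continuous_arccos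
  obtain ⟨M, hM⟩ := exists_bound_comp_dot (q := q) hK
  have hω := omega_pos (q := q)
  have hne : sigma q Set.univ ≠ 0 := fun h => by
    rw [← sigma_univ_toReal, measureReal_def, h] at hω
    simp at hω
  have hprob : IsProbabilityMeasure (nu q) := ⟨by
    rw [nu, Measure.smul_apply, smul_eq_mul, ENNReal.inv_mul_cancel hne (measure_ne_top _ _)]⟩
  have hint : Integrable (fun p : Sph q × Sph q => ψ (Real.arccos (dot p.1 p.2)))
      ((nu q).prod (nu q)) :=
    Integrable.of_bound (hK.comp continuous_dot).aestronglyMeasurable M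
      (Filter.Eventually.of_forall fun p => hM p.1 p.2)
  have hinner : ∀ x : Sph q, ∫ y, ψ (Real.arccos (dot x y)) ∂(nu q) = kernelCoeff q ψ 0 := by
    intro x
    rw [kernelCoeff, gegenbauerCoeff_eq_zonalMeasure hq x, nu, integral_smul_measure,
      basisPoly_zero]
    simp only [eval_one, mul_one, one_pow]
    rw [integral_zonalMeasure x hK.aestronglyMeasurable, integral_const, zonalMeasure_real_univ,
      ENNReal.toReal_inv, ← measureReal_def, sigma_univ_toReal, smul_eq_mul, smul_eq_mul, mul_one,
      div_eq_inv_mul]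
    simp only [dot_comm x]
  unfold nullMean angle
  rw [integral_prod _ hint]
  simp [hinner]

lemma omega_mul_gegenbauerCoeff_zero (hq : 1 ≤ q) (μ : Sph q) {g : ℝ → ℝ}
    (hg : MemLp g 2 (weightMeasure q)) :
    omega q * gegenbauerCoeff q g 0 = ∫ x, g (dot x μ) ∂(sigma q) := by
  have hgz := memLp_zonalMeasure hq μ hg
  rw [gegenbauerCoeff_eq_zonalMeasure hq μ, basisPoly_zero]
  simp only [eval_one, mul_one, one_pow]
  rw [integral_zonalMeasure μ hgz.1, integral_const, zonalMeasure_real_univ, smul_eq_mul, mul_one,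
    mul_div_cancel₀ _ omega_pos.ne']

lemma tau_zero (q : ℕ) : tau q 0 = 1 := by
  by_cases h : q = 1 <;> norm_num [tau, h]

lemma two_mul_card_filter_lt (n : ℕ) :
    2 * (((Finset.univ : Finset (Fin n × Fin n)).filter fun p => p.1 < p.2).card : ℝ) =
      n * ((n : ℝ) - 1) := by
  have h : ((Finset.univ : Finset (Fin n × Fin n)).filter fun p => p.1 < p.2).card =
      ∑ j ∈ Finset.range n, j := by
    rw [Finset.card_filter, Fintype.sum_prod_type_right, ← Fin.sum_univ_eq_sum_range]
    refine Finset.sum_congr rfl fun j _ => ?_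
    rw [← Finset.card_filter, Finset.filter_gt_eq_Iio, Fin.card_Iio]
  have h2 := Finset.sum_range_id_mul_two n
  rw [h]
  rcases Nat.eq_zero_or_pos n with rfl | hn
  · simp
  · rw [← Nat.cast_pred hn, mul_comm]
    exact_mod_cast h2

variable {Ω : Type*} [MeasurableSpace Ω] {P : Measure Ω} [IsProbabilityMeasure P]

lemma integrable_kernel_pair {K : ℝ → ℝ} (hK : Continuous K) {Y Z : Ω → Sph q}
    (hY : AEMeasurable Y P) (hZ : AEMeasurable Z P) :
    Integrable (fun w => K (dot (Y w) (Z w))) P := by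
  obtain ⟨M, hM⟩ := exists_bound_comp_dot (q := q) hK
  have hc : Continuous fun p : Sph q × Sph q => K (dot p.1 p.2) := hK.comp continuous_dot
  exact Integrable.of_bound
    (hc.measurable.comp_aemeasurable (hY.prodMk hZ)).aestronglyMeasurable M
    (Filter.Eventually.of_forall fun w => hM _ _)

/-- Independence makes the joint law a product; nonnegativity of the density lets the truncation
`ENNReal.ofReal` be undone. -/
lemma integral_kernel_pair {K : ℝ → ℝ} (hK : Continuous K) {f : Sph q → ℝ}
    (hf : Integrable f (sigma q)) (hf0 : 0 ≤ᵐ[sigma q] f) {Y Z : Ω → Sph q}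
    (hYZ : IndepFun Y Z P)
    (hY : HasLaw Y ((sigma q).withDensity fun x => ENNReal.ofReal (f x)) P)
    (hZ : HasLaw Z ((sigma q).withDensity fun x => ENNReal.ofReal (f x)) P) :
    ∫ w, K (dot (Y w) (Z w)) ∂P =
      ∫ x, f x * ∫ y, K (dot x y) * f y ∂(sigma q) ∂(sigma q) := by
  set ρ := (sigma q).withDensity fun x => ENNReal.ofReal (f x) with hρ
  have hfin : IsFiniteMeasure ρ := isFiniteMeasure_withDensity_ofReal hf.2
  obtain ⟨M, hM⟩ := exists_bound_comp_dot (q := q) hK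
  have hc : Continuous fun p : Sph q × Sph q => K (dot p.1 p.2) := hK.comp continuous_dot
  have hdens : ∀ F : Sph q → ℝ, ∫ x, F x ∂ρ = ∫ x, f x * F x ∂(sigma q) := by
    intro F
    rw [hρ, integral_withDensity_eq_integral_toReal_smul₀ hf.1.aemeasurable.ennreal_ofReal
      (Filter.Eventually.of_forall fun _ => ENNReal.ofReal_lt_top)]
    refine integral_congr_ae ?_
    filter_upwards [hf0] with x hx
    rw [ENNReal.toReal_ofReal hx, smul_eq_mul]
  have hmap := (indepFun_iff_map_prod_eq_prod_map_map hY.aemeasurable hZ.aemeasurable).1 hYZ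
  rw [hY.map_eq, hZ.map_eq] at hmap
  have h1 : ∫ w, K (dot (Y w) (Z w)) ∂P = ∫ p, K (dot p.1 p.2) ∂(ρ.prod ρ) := by
    rw [← hmap, integral_map (hY.aemeasurable.prodMk hZ.aemeasurable) hc.aestronglyMeasurable]
  rw [h1, integral_prod _ (Integrable.of_bound hc.aestronglyMeasurable M
    (Filter.Eventually.of_forall fun p => hM p.1 p.2)), hdens]
  simp only [hdens, mul_comm (f _) (K _)]

end Probability

end

end SphereTest

/-! ### The expectation of the statistic under the alternative. -/

theorem proposition5 {Ω : Type*} [MeasurableSpace Ω] (P : Measure Ω) [IsProbabilityMeasure P]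
    (q n : ℕ) (hq : 1 ≤ q) (hn : 1 ≤ n)
    (ψ : ℝ → ℝ)
    (hψ : (∃ κ : ℝ, 0 < κ ∧ ψ = SphereTest.smoothMaxKernel κ) ∨
      (∃ ρ : ℝ, 0 < ρ ∧ ρ < 1 ∧ ψ = SphereTest.poissonKernel q ρ))
    (μ : SphereTest.Sph q) (g : ℝ → ℝ)
    (hg : MemLp g 2 (SphereTest.weightMeasure q))
    (hg_nonneg : ∀ᵐ x ∂(SphereTest.sigma q), 0 ≤ g (SphereTest.dot x μ))
    (hg_one : ∫ x, g (SphereTest.dot x μ) ∂(SphereTest.sigma q) = 1)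
    (X : Fin n → Ω → SphereTest.Sph q)
    (hX_indep : iIndepFun X P)
    (hX_law : ∀ i, HasLaw (X i)
      ((SphereTest.sigma q).withDensity fun x => ENNReal.ofReal (g (SphereTest.dot x μ))) P) :
    Integrable (fun w => SphereTest.testStat ψ (fun i => X i w)) P ∧
    Summable (fun k : ℕ => SphereTest.tau q (k + 1) * SphereTest.kernelCoeff q ψ (k + 1) *
      SphereTest.gegenbauerCoeff q g (k + 1) ^ 2) ∧
    ∫ w, SphereTest.testStat ψ (fun i => X i w) ∂P =
      SphereTest.omega q ^ 2 * ((n : ℝ) - 1) *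
        ∑' k : ℕ, SphereTest.tau q (k + 1) * SphereTest.kernelCoeff q ψ (k + 1) *
          SphereTest.gegenbauerCoeff q g (k + 1) ^ 2 := by
  open SphereTest in
  have hψc : Continuous ψ := by
    rcases hψ with ⟨κ, _, rfl⟩ | ⟨ρ, h0, h1, rfl⟩
    · exact continuous_smoothMaxKernel κ
    · exact continuous_poissonKernel q h0 h1
  have hK : Continuous fun t => ψ (Real.arccos t) := hψc.comp Real.continuous_arccos
  have hω := omega_pos (q := q)
  have hf : Integrable (fun x => g (dot x μ)) (sigma q) :=
    ((memLp_zonalMeasure hq μ hg).comp_measurePreserving (measurePreserving_dot μ)).integrable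
      (by norm_num)
  set E := ∫ y, g (dot y μ) * ∫ x, ψ (Real.arccos (dot y x)) * g (dot x μ) ∂(sigma q) ∂(sigma q)
    with hE
  have hsum : HasSum (fun k => omega q ^ 2 * (tau q k * kernelCoeff q ψ k *
      gegenbauerCoeff q g k ^ 2)) E := hasSum_kernel_energy hq hK μ hg
  -- Since g has total mass one, ω e₀ = 1; the centring of the statistic thus removes exactly the
  -- term k = 0.
  have h0 : omega q ^ 2 * (tau q 0 * kernelCoeff q ψ 0 * gegenbauerCoeff q g 0 ^ 2) =
      nullMean q ψ := by
    have := omega_mul_gegenbauerCoeff_zero hq μ hg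
    rw [hg_one] at this
    rw [nullMean_eq hq hψc, tau_zero]
    linear_combination kernelCoeff q ψ 0 * (omega q * gegenbauerCoeff q g 0 + 1) * this
  have hsum' : HasSum (fun k => omega q ^ 2 * (tau q (k + 1) * kernelCoeff q ψ (k + 1) *
      gegenbauerCoeff q g (k + 1) ^ 2)) (E - nullMean q ψ) := by
    rw [← h0]
    simpa using (hasSum_nat_add_iff' 1).2 hsum
  have hsum'' : HasSum (fun k => tau q (k + 1) * kernelCoeff q ψ (k + 1) *
      gegenbauerCoeff q g (k + 1) ^ 2) ((omega q ^ 2)⁻¹ * (E - nullMean q ψ)) := by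
    refine (hsum'.mul_left (omega q ^ 2)⁻¹).congr_fun fun k => ?_
    rw [inv_mul_cancel_left₀ (by positivity)]
  have hpair : ∀ i j, Integrable (fun w => ψ (angle (X i w) (X j w))) P := fun i j =>
    integrable_kernel_pair hK (hX_law i).aemeasurable (hX_law j).aemeasurable
  have hterm : ∀ p : Fin n × Fin n,
      Integrable (fun w => ψ (angle (X p.1 w) (X p.2 w)) - nullMean q ψ) P := fun p =>
    (hpair p.1 p.2).sub (integrable_const _)
  refine ⟨(integrable_finsetSum _ fun p _ => hterm p).const_mul _, hsum''.summable, ?_⟩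
  have hmean : ∀ p ∈ (Finset.univ : Finset (Fin n × Fin n)).filter (fun p => p.1 < p.2),
      ∫ w, (ψ (angle (X p.1 w) (X p.2 w)) - nullMean q ψ) ∂P = E - nullMean q ψ := by
    intro p hp
    rw [integral_sub (hpair p.1 p.2) (integrable_const _), integral_const, probReal_univ, one_smul]
    congr 1
    exact integral_kernel_pair hK hf hg_nonneg
      (hX_indep.indepFun (Finset.mem_filter.1 hp).2.ne) (hX_law p.1) (hX_law p.2)
  have hn0 : (n : ℝ) ≠ 0 := by positivity
  unfold testStat
  rw [hsum''.tsum_eq, integral_const_mul, integral_finsetSum _ fun p _ => hterm p,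
    Finset.sum_congr rfl hmean, Finset.sum_const, nsmul_eq_mul]
  have hcard := two_mul_card_filter_lt n
  field_simp
  -- All pairs have the same mean, and 2/n times their number is n - 1.
  linear_combination (E - nullMean q ψ) * hcard
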